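/- Let $\mathcal X$ be a measurable space of contexts, $K\ge 1$, $[K]=\{1,\dots,K\}$ the set of arms, $P_X$ a probability measure on $\mathcal X$, and $P_{Y|A,X}$ a Markov kernel from $\mathcal X\times[K]$ to $\mathbb R$ (the law of the outcome $Y$ given the context and the arm). Put $$g(x,a)=\mathbb E[Y\mid A=a,X=x],\quad v(x,a)=\mathbb E[(Y-g(x,a))^2\mid A=a,X=x],\quad \mu(a)=\mathbb E_{P_X}[g(X,a)].$$ Assume the following. 1. There is a unique optimal arm $a^*$: $\mu(a)<\mu(a^*)$ for all $a\ne a^*$. 2. $v(x,a)>0$ for every $a$ and $P_X$-almost every $x$. 3. Outcomes are bounded: for some $B$, every $a$ and $P_X$-a.e. $x$, $|Y|<B$ almost surely under $P_{Y|A=a,X=x}$. 4. (A2) $(g_t)_{t\in\mathbb N}$ is a sequence of random regression functions $\mathcal X\times[K]\to\mathbb R$, measurable in $x$, and $g_\infty:\mathcal X\times[K]\to\mathbb R$ is a measurable (non-random) function such that, almost surely, $\|g_t(\cdot,a)-g_\infty(\cdot,a)\|_{L_2(P_X)}\to0$ for all $a$, and $\sup_{t,x,a}|g_t(x,a)|<\infty$.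 5. (A3) $\pi_\infty$ is a policy (an element of the set $\Pi$ below) for which the matrix $\Sigma_\infty(i,j)=\mathbb E_{P_{\pi_\infty}}[(\phi_{\pi_\infty}(i)-\mu(i))(\phi_{\pi_\infty}(j)-\mu(j))]$ is invertible. Here $\Pi$ is the set of measurable $\pi:\mathcal X\times[K]\to\mathbb R$ with $\pi(x,\cdot)\ge0$ and $\sum_b\pi(x,b)=1$ for $P_X$-a.e. $x$; $P_\pi=P_X\times P_{A\sim\pi(X,\cdot)}\times P_{Y|A,X}$ is the joint law of $(X,A,Y)$ under $\pi$; and $$\phi_\pi(b)=g_\infty(X,b)+\frac{\mathbf 1[A=b]\,(Y-g_\infty(X,b))}{\pi(X,b)} .$$ For $a\in[K]$ let $\Delta(a)$ be the set of $w\in\mathbb R^K$ with $w(a)=-1$, $w(b)\ge0$ for $b\neq a$, and $\sum_{b\ne a}w(b)=1$. For $\pi\in\Pi$ define, with values in $[0,\infty]$, $$G(\pi)=\max_{a\ne a^*}F_a(\pi),\qquad F_a(\pi)=\min_{w\in\Delta(a),\ w^\top\mu\ge0}f(\pi,w),\qquad f(\pi,w)=\frac{\mathbb E_{P_\pi}\big[\big(\sum_b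 w(b)(\phi_\pi(b)-\mu(b))\big)^2\big]}{\big(\sum_b w(b)\mu(b)\big)^2},$$ with the convention $1/0=\infty$; in particular $f(\pi,w)=\infty$ if $w(b)\ne0$ for some $b$ such that $\pi(X,b)=0$ with positive $P_X$-probability. (For $K=1$ the maximum over the empty set is $0$.) Then $G$ has a minimizer $\pi_*$ over $\Pi$, it is unique up to $P_X$-null sets, and there is $\theta_*\in\mathbb R^K$ with $\theta_*(K)=0$ such that, for $P_X$-a.e. $x$ and all $b\in[K]$, $$\pi_*(x,b)^{-1}=\sum_{a\in[K]}\sqrt{\frac{V(x,a)}{V(x,b)}}\;\exp\big(\theta_*(a)-\theta_*(b)\big),$$ where $V(x,a)=v(x,a)+r_\infty(x,a)^2$ and $r_\infty(x,a)=g_\infty(x,a)-g(x,a)$. -/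

import Mathlib

open MeasureTheory ProbabilityTheory Filter Topology
open scoped ENNReal

namespace BAI

/-! Contexts live in a measurable space `X`, arms are `Fin K`, contexts have law `PX`, and
`κ (x, a)` is the conditional law of the outcome given context `x` and arm `a`. -/

noncomputable section

variable {X : Type*} [MeasurableSpace X] {K : ℕ}

/-- Conditional mean `g(x,a) = E[Y | A = a, X = x]`. -/
def condMean (κ : Kernel (X × Fin K) ℝ) (x : X) (a : Fin K) : ℝ :=
  ∫ y, y ∂(κ (x, a))

/-- Conditional variance `v(x,a) = E[(Y - g(x,a))² | A = a, X = x]`. -/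
def condVar (κ : Kernel (X × Fin K) ℝ) (x : X) (a : Fin K) : ℝ :=
  ∫ y, (y - condMean κ x a) ^ 2 ∂(κ (x, a))

/-- Arm mean `μ(a) = E_{PX}[g(X,a)]`. -/
def armMean (PX : Measure X) (κ : Kernel (X × Fin K) ℝ) (a : Fin K) : ℝ :=
  ∫ x, condMean κ x a ∂PX

/-- `astar` is the unique arm of largest mean. -/
def UniqueOptimalArm (PX : Measure X) (κ : Kernel (X × Fin K) ℝ) (astar : Fin K) : Prop :=
  ∀ a, a ≠ astar → armMean PX κ a < armMean PX κ astar

/-- The conditional variances are positive. -/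
def NondegenerateVariances (PX : Measure X) (κ : Kernel (X × Fin K) ℝ) : Prop :=
  ∀ a, ∀ᵐ x ∂PX, 0 < condVar κ x a

/-- Outcomes are bounded in absolute value by a constant. -/
def BoundedOutcomes (PX : Measure X) (κ : Kernel (X × Fin K) ℝ) : Prop :=
  ∃ B : ℝ, ∀ a, ∀ᵐ x ∂PX, ∀ᵐ y ∂(κ (x, a)), |y| < B

/-- The policy class `Π`: measurable nonnegative functions that sum to one, `PX`-almost surely. -/
structure IsPolicy (PX : Measure X) (π : X → Fin K → ℝ) : Prop where
  measurable : ∀ a, Measurable fun x => π x a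
  nonneg : ∀ᵐ x ∂PX, ∀ a, 0 ≤ π x a
  sum_eq_one : ∀ᵐ x ∂PX, ∑ a, π x a = 1

/-- The joint law `PX × P_{A ∼ π(X,·)} × P_{Y|A,X}` of `(X, A, Y)`. -/
def jointLaw (PX : Measure X) (κ : Kernel (X × Fin K) ℝ) (π : X → Fin K → ℝ) :
    Measure (X × Fin K × ℝ) :=
  ∑ a, (((PX.withDensity fun x => ENNReal.ofReal (π x a)) ⊗ₘ
      (κ.comap (fun x => (x, a)) (measurable_id.prodMk measurable_const))).map
        fun p => (p.1, a, p.2))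

/-- The score `φ(b) = g(X,b) + 1[A = b] (Y - g(X,b)) / π(X,b)` at `z = (X, A, Y)`. -/
def score (ginf : X → Fin K → ℝ) (π : X → Fin K → ℝ) (b : Fin K) (z : X × Fin K × ℝ) : ℝ :=
  ginf z.1 b + (if z.2.1 = b then z.2.2 - ginf z.1 b else 0) / π z.1 b

/-- The covariance matrix of the scores under the joint law induced by `π`. -/
def scoreCov (PX : Measure X) (κ : Kernel (X × Fin K) ℝ) (ginf : X → Fin K → ℝ)
    (π : X → Fin K → ℝ) : Matrix (Fin K) (Fin K) ℝ :=
  Matrix.of fun i j => ∫ z, (score ginf π i z - armMean PX κ i) *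
    (score ginf π j z - armMean PX κ j) ∂(jointLaw PX κ π)

/-- Almost surely, the random regression functions `gseq t` are uniformly bounded and converge to
`ginf` in `L₂(PX)`, for every arm. -/
def RegressionConverges {Ω : Type*} [MeasurableSpace Ω] (P : Measure Ω) (PX : Measure X)
    (gseq : ℕ → Ω → X → Fin K → ℝ) (ginf : X → Fin K → ℝ) : Prop :=
  (∀ t ω a, Measurable fun x => gseq t ω x a) ∧
  (∀ a, Measurable fun x => ginf x a) ∧
  ∀ᵐ ω ∂P,
    (∀ a, Tendsto (fun t => eLpNorm (fun x => gseq t ω x a - ginf x a) 2 PX) atTop (𝓝 0)) ∧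
    ∃ B : ℝ, ∀ t x a, |gseq t ω x a| ≤ B

/-- `Δ(a)`: the `a`-th entry is `-1` and the other entries form a probability vector. -/
def contrastWeights (a : Fin K) : Set (Fin K → ℝ) :=
  {w | w a = -1 ∧ (∀ b, b ≠ a → 0 ≤ w b) ∧ ∑ b ∈ Finset.univ.erase a, w b = 1}

open scoped Classical in
/-- The squared inverse signal-to-noise ratio `f(π, w)`, with values in `[0, ∞]`. Here `1/0 = ∞`:
the value is `∞` if `w` puts nonzero weight on an arm whose propensity vanishes with positive
`PX`-probability. -/
def invSNRSq (PX : Measure X) (κ : Kernel (X × Fin K) ℝ) (ginf : X → Fin K → ℝ)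
    (π : X → Fin K → ℝ) (w : Fin K → ℝ) : ℝ≥0∞ :=
  if ∀ b, w b ≠ 0 → ∀ᵐ x ∂PX, 0 < π x b then
    (∫⁻ z, ENNReal.ofReal ((∑ b, w b * (score ginf π b z - armMean PX κ b)) ^ 2)
        ∂(jointLaw PX κ π)) /
      ENNReal.ofReal ((∑ b, w b * armMean PX κ b) ^ 2)
  else ∞

/-- `F_a(π)`: the minimum of `f(π, w)` over `w ∈ Δ(a)` with `w ⬝ μ ≥ 0`. -/
def armObjective (PX : Measure X) (κ : Kernel (X × Fin K) ℝ) (ginf : X → Fin K → ℝ)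
    (a : Fin K) (π : X → Fin K → ℝ) : ℝ≥0∞ :=
  ⨅ w ∈ {w ∈ contrastWeights a | 0 ≤ ∑ b, w b * armMean PX κ b}, invSNRSq PX κ ginf π w

/-- The objective `G(π) = max_{a ≠ a*} F_a(π)`. -/
def objective (PX : Measure X) (κ : Kernel (X × Fin K) ℝ) (ginf : X → Fin K → ℝ)
    (astar : Fin K) (π : X → Fin K → ℝ) : ℝ≥0∞ :=
  ⨆ a ∈ {a : Fin K | a ≠ astar}, armObjective PX κ ginf a π

/-- `π` minimizes `G` over the policy class. -/
def IsOptimalPolicy (PX : Measure X) (κ : Kernel (X × Fin K) ℝ) (ginf : X → Fin K → ℝ)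
    (astar : Fin K) (π : X → Fin K → ℝ) : Prop :=
  IsPolicy PX π ∧
    ∀ π', IsPolicy PX π' → objective PX κ ginf astar π ≤ objective PX κ ginf astar π'

/-- `V(x,a) = v(x,a) + r(x,a)²`, where `r = ginf - g` is the limiting regression error. -/
def totalVar (κ : Kernel (X × Fin K) ℝ) (ginf : X → Fin K → ℝ) (x : X) (a : Fin K) : ℝ :=
  condVar κ x a + (ginf x a - condMean κ x a) ^ 2

end

end BAI

/-! Averaging over the arm and the outcome at a context x, the second moment of a centred contrast
`w` of scores is ∑ w(b)² V(x,b)/π(x,b) plus a term free of π (`sum_lintegral_score_sq`). Hence the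
policy matters only through the costs c_b(π) = E[V(X,b)/π(X,b)]. If some propensity vanishes with
positive probability or some cost is infinite, then G(π) = ∞ (`objective_eq_top`). Otherwise the
second-moment form is positive definite and G is a maximum over pairs, G(π) = max over a ≠ a* of
(c_{a*} + c_a + C_a)/d_a, where d_a = (μ(a*) - μ(a))² and C_a is free of π. Testing the contrast of
a* and a gives ≤ (`IsFinitePolicy.objective_le`); ≥ is `exists_contrast_lower_bound`, where the arm
indexing the contrast set may differ from a.

What remains is a convex minimax problem. Take l_a ≥ 0 with ∑ d_a l_a = 1 over a ≠ a*, and let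
l_{a*} be the sum of the other l_a. Then d_a l_a are averaging weights, so G(π) ≥ ∑ l_b c_b + ∑ l_a
C_a. Context by context, Cauchy-Schwarz gives ∑ l_b V_b/π_b ≥ (∑ √(l_b V_b))², with equality only
for π_b proportional to √(l_b V_b), the allocation `neyman`. Minimizing over π thus leaves the
concave function `dualValue` of l, which involves the contexts only through E√(V_b V_c) and the
constants C_a.

A maximizer l exists by compactness; the infinite slope of the square root at 0 forces l > 0, and
stationarity bounds every pairwise value of the Neyman allocation by the dual value
(`exists_multipliers`). That allocation is therefore optimal, any other optimal policy attains
equality in Cauchy-Schwarz and coincides with it almost everywhere, and θ_* is ½ log l, shifted to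
vanish at the last arm. -/

namespace BAI

/-! ### Finite-dimensional convex analysis: the concave allocation value. -/

section FiniteDimensional

variable {ι : Type*} [Fintype ι]

/-- The value `∑ √(l b) √(l c) M b c` of the weighted allocation problem. -/
noncomputable def allocValue (M : ι → ι → ℝ) (l : ι → ℝ) : ℝ :=
  ∑ b, ∑ c, √(l b) * √(l c) * M b c

/-- The integrated inverse propensity of arm `b` under the allocation with weights `l`. -/
noncomputable def allocCost (M : ι → ι → ℝ) (l : ι → ℝ) (b : ι) : ℝ :=
  ∑ c, √(l c) / √(l b) * M b c

/-- Euler's identity: for symmetric `M`, `allocValue M` is homogeneous of degree one with gradient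
`allocCost M l` at positive `l`. -/
lemma allocValue_eq {M : ι → ι → ℝ} {l : ι → ℝ} (hl : ∀ b, 0 < l b) :
    allocValue M l = ∑ b, l b * allocCost M l b := by
  unfold allocValue allocCost
  refine Finset.sum_congr rfl fun b _ => ?_
  rw [Finset.mul_sum]
  refine Finset.sum_congr rfl fun c _ => ?_
  have h := Real.sqrt_pos.2 (hl b)
  nth_rewrite 2 [← Real.mul_self_sqrt (hl b).le]
  field_simp

/-- The tangent-plane inequality of a concave function, proved without derivatives so that `l` may
have zero coordinates. Symmetrizing in b, c reduces it to AM-GM, 2√(l_b l_c) ≤ l_b √(k_c/k_b) + l_c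
√(k_b/k_c). -/
lemma allocValue_le {M : ι → ι → ℝ} (hM : ∀ b c, 0 ≤ M b c) (hsymm : ∀ b c, M b c = M c b)
    {l k : ι → ℝ} (hl : ∀ b, 0 ≤ l b) (hk : ∀ b, 0 < k b) :
    allocValue M l ≤ ∑ b, l b * allocCost M k b := by
  have h1 : ∑ b, l b * allocCost M k b = ∑ b, ∑ c, l b * (√(k c) / √(k b)) * M b c := by
    unfold allocCost
    refine Finset.sum_congr rfl fun b _ => ?_
    rw [Finset.mul_sum]
    exact Finset.sum_congr rfl fun c _ => by ring
  have h2 : ∑ b, l b * allocCost M k b = ∑ b, ∑ c, l c * (√(k b) / √(k c)) * M b c := by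
    rw [h1, Finset.sum_comm]
    exact Finset.sum_congr rfl fun b _ => Finset.sum_congr rfl fun c _ => by rw [hsymm]
  have h3 : 2 * allocValue M l ≤ ∑ b, l b * allocCost M k b + ∑ b, l b * allocCost M k b := by
    nth_rewrite 1 [h1]
    rw [h2, ← Finset.sum_add_distrib, allocValue, Finset.mul_sum]
    refine Finset.sum_le_sum fun b _ => ?_
    rw [← Finset.sum_add_distrib, Finset.mul_sum]
    refine Finset.sum_le_sum fun c _ => ?_
    rw [← add_mul, ← mul_assoc]
    refine mul_le_mul_of_nonneg_right ?_ (hM b c)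
    have hb := Real.sqrt_pos.2 (hk b)
    have hc := Real.sqrt_pos.2 (hk c)
    rw [← sub_nonneg]
    have : l b * (√(k c) / √(k b)) + l c * (√(k b) / √(k c)) - 2 * (√(l b) * √(l c)) =
        (√(l b) * √(k c) - √(l c) * √(k b)) ^ 2 / (√(k b) * √(k c)) := by
      nth_rewrite 1 [← Real.mul_self_sqrt (hl b)]
      nth_rewrite 1 [← Real.mul_self_sqrt (hl c)]
      field_simp
      ring
    rw [this]
    positivity
  linarith

lemma allocCost_nonneg {M : ι → ι → ℝ} (hM : ∀ b c, 0 ≤ M b c) (l : ι → ℝ) (b : ι) :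
    0 ≤ allocCost M l b :=
  Finset.sum_nonneg fun c _ => mul_nonneg (by positivity) (hM b c)

/-! ### Quadratic forms. -/

/-- The quadratic form of a matrix. -/
def quadForm (S : ι → ι → ℝ) (w : ι → ℝ) : ℝ := ∑ b, ∑ c, w b * w c * S b c

lemma quadForm_add_smul {S : ι → ι → ℝ} (hS : ∀ b c, S b c = S c b) (w z : ι → ℝ) (t : ℝ) :
    quadForm S (fun b => w b + t * z b) =
      quadForm S w + 2 * t * (∑ b, w b * ∑ c, S b c * z c) + t ^ 2 * quadForm S z := by
  have h : ∑ b, w b * ∑ c, S b c * z c = ∑ b, ∑ c, w b * z c * S b c :=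
    Finset.sum_congr rfl fun b _ => by
      rw [Finset.mul_sum]
      exact Finset.sum_congr rfl fun c _ => by ring
  have h' : ∑ b, w b * ∑ c, S b c * z c = ∑ b, ∑ c, w c * z b * S b c := by
    rw [h, Finset.sum_comm]
    exact Finset.sum_congr rfl fun b _ => Finset.sum_congr rfl fun c _ => by rw [hS]
  have h2 : 2 * t * (∑ b, w b * ∑ c, S b c * z c) =
      t * (∑ b, ∑ c, w b * z c * S b c) + t * (∑ b, ∑ c, w c * z b * S b c) := by
    rw [← h, ← h']; ring
  rw [h2]
  simp only [quadForm, Finset.mul_sum, ← Finset.sum_add_distrib]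
  exact Finset.sum_congr rfl fun b _ => Finset.sum_congr rfl fun c _ => by ring

lemma sq_bilin_le_quadForm_mul {S : ι → ι → ℝ} (hS : ∀ b c, S b c = S c b)
    (hpos : ∀ w, 0 ≤ quadForm S w) {z : ι → ℝ} (hz : 0 < quadForm S z) (w : ι → ℝ) :
    (∑ b, w b * ∑ c, S b c * z c) ^ 2 ≤ quadForm S w * quadForm S z := by
  set B := ∑ b, w b * ∑ c, S b c * z c with hB
  -- This coefficient minimizes the form along the line through `w` in direction `z`; nonnegativity
  -- there is Cauchy-Schwarz.
  have h := hpos (fun b => w b + (-B / quadForm S z) * z b)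
  rw [quadForm_add_smul hS, ← hB] at h
  have : quadForm S w + 2 * (-B / quadForm S z) * B + (-B / quadForm S z) ^ 2 * quadForm S z =
      (quadForm S w * quadForm S z - B ^ 2) / quadForm S z := by
    field_simp
    ring
  rw [this] at h
  have := (div_nonneg_iff.1 h).resolve_right (fun h => by linarith [h.2])
  linarith [this.1]

/-! ### The dual problem over the multipliers. -/

variable [DecidableEq ι]

/-- Multipliers of the max problem: the weight of `s` is the sum of the other weights. -/
def multipliers (s : ι) (e : ι → ℝ) : Set (ι → ℝ) :=
  {l | (∀ a, a ≠ s → 0 ≤ l a) ∧ l s = ∑ a ∈ Finset.univ.erase s, l a ∧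
    ∑ a ∈ Finset.univ.erase s, e a * l a = 1}

/-- The dual objective. -/
noncomputable def dualValue (M : ι → ι → ℝ) (C : ι → ℝ) (s : ι) (l : ι → ℝ) : ℝ :=
  allocValue M l + ∑ a ∈ Finset.univ.erase s, l a * C a

/-- Arm `s` takes part in every pair, so its weight distributes over the pairs. -/
lemma multipliers_sum {s : ι} {e l : ι → ℝ} (hl : l ∈ multipliers s e) (x : ι → ℝ) :
    ∑ b, l b * x b = ∑ a ∈ Finset.univ.erase s, l a * (x s + x a) := by
  rw [← Finset.add_sum_erase _ _ (Finset.mem_univ s), hl.2.1, Finset.sum_mul,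
    ← Finset.sum_add_distrib]
  exact Finset.sum_congr rfl fun a _ => by ring

lemma multipliers_pos {s : ι} {e l : ι → ℝ} (hl : l ∈ multipliers s e) : 0 < l s := by
  rw [hl.2.1]
  have h0 : ∀ a ∈ Finset.univ.erase s, 0 ≤ l a := fun a ha => hl.1 a (Finset.ne_of_mem_erase ha)
  refine lt_of_le_of_ne (Finset.sum_nonneg h0) fun h => ?_
  have h1 := (Finset.sum_eq_zero_iff_of_nonneg h0).1 h.symm
  have h2 := hl.2.2
  rw [Finset.sum_eq_zero fun a ha => by rw [h1 a ha, mul_zero]] at h2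
  exact zero_ne_one h2

lemma multipliers_nonneg {s : ι} {e l : ι → ℝ} (hl : l ∈ multipliers s e) (b : ι) : 0 ≤ l b := by
  rcases eq_or_ne b s with rfl | h
  · exact (multipliers_pos hl).le
  · exact hl.1 b h

lemma convex_multipliers (s : ι) (e : ι → ℝ) : Convex ℝ (multipliers s e) := by
  rintro l ⟨h1, h2, h3⟩ k ⟨g1, g2, g3⟩ p q hp hq hpq
  refine ⟨fun a ha => ?_, ?_, ?_⟩
  · have := h1 a ha
    have := g1 a ha
    simp only [Pi.add_apply, Pi.smul_apply, smul_eq_mul]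
    positivity
  · simp only [Pi.add_apply, Pi.smul_apply, smul_eq_mul]
    rw [Finset.sum_add_distrib, ← Finset.mul_sum, ← Finset.mul_sum, ← h2, ← g2]
  · simp only [Pi.add_apply, Pi.smul_apply, smul_eq_mul]
    calc _ = p * ∑ a ∈ Finset.univ.erase s, e a * l a
          + q * ∑ a ∈ Finset.univ.erase s, e a * k a := by
            rw [Finset.mul_sum, Finset.mul_sum, ← Finset.sum_add_distrib]
            exact Finset.sum_congr rfl fun a _ => by ring
      _ = 1 := by rw [h3, g3]; linarith

lemma isCompact_multipliers {s : ι} {e : ι → ℝ} (he : ∀ a, a ≠ s → 0 < e a) :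
    IsCompact (multipliers s e) := by
  have hcl : IsClosed (multipliers s e) := by
    have : multipliers s e = (⋂ a, ⋂ (_ : a ≠ s), {l : ι → ℝ | 0 ≤ l a}) ∩
        ({l : ι → ℝ | l s = ∑ a ∈ Finset.univ.erase s, l a} ∩
        {l : ι → ℝ | ∑ a ∈ Finset.univ.erase s, e a * l a = 1}) := by
      ext l
      simp [multipliers]
    rw [this]
    refine IsClosed.inter (isClosed_iInter fun a => isClosed_iInter fun _ => ?_)
      (IsClosed.inter ?_ ?_)
    · exact isClosed_le continuous_const (continuous_apply a)
    · exact isClosed_eq (continuous_apply s)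
        (continuous_finsetSum _ fun a _ => continuous_apply a)
    · exact isClosed_eq (continuous_finsetSum _ fun a _ =>
        continuous_const.mul (continuous_apply a)) continuous_const
  have hle : ∀ l ∈ multipliers s e, ∀ a, a ≠ s → l a ≤ 1 / e a := by
    intro l hl a ha
    rw [le_div_iff₀ (he a ha), mul_comm, ← hl.2.2]
    exact Finset.single_le_sum (f := fun a => e a * l a)
      (fun b hb => mul_nonneg (he b (Finset.ne_of_mem_erase hb)).le
        (hl.1 b (Finset.ne_of_mem_erase hb))) (Finset.mem_erase.2 ⟨ha, Finset.mem_univ a⟩)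
  refine (isCompact_Icc (a := (0 : ι → ℝ)) (b := fun b => if b = s then
    ∑ a ∈ Finset.univ.erase s, 1 / e a else 1 / e b)).of_isClosed_subset hcl fun l hl => ?_
  refine ⟨fun b => multipliers_nonneg hl b, fun b => ?_⟩
  by_cases h : b = s
  · simp only [h, if_true]
    rw [hl.2.1]
    exact Finset.sum_le_sum fun a ha => hle l hl a (Finset.ne_of_mem_erase ha)
  · simp only [h, if_false]
    exact hle l hl b h

lemma dualValue_eq {M : ι → ι → ℝ} {C : ι → ℝ} {s : ι} {e l : ι → ℝ}
    (hl : l ∈ multipliers s e) (hpos : ∀ b, 0 < l b) :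
    dualValue M C s l = ∑ a ∈ Finset.univ.erase s,
      l a * (allocCost M l s + allocCost M l a + C a) := by
  rw [dualValue, allocValue_eq hpos, multipliers_sum hl, ← Finset.sum_add_distrib]
  exact Finset.sum_congr rfl fun a _ => by ring

lemma dualValue_le {M : ι → ι → ℝ} (hM : ∀ b c, 0 ≤ M b c) (hsymm : ∀ b c, M b c = M c b)
    {C : ι → ℝ} {s : ι} {e l k : ι → ℝ} (hl : l ∈ multipliers s e) (hpos : ∀ b, 0 < k b) :
    dualValue M C s l ≤ ∑ a ∈ Finset.univ.erase s,
      l a * (allocCost M k s + allocCost M k a + C a) := by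
  have h := allocValue_le hM hsymm (multipliers_nonneg hl) hpos
  rw [multipliers_sum hl] at h
  calc _ ≤ _ := add_le_add_left h _
    _ = _ := by
      rw [← Finset.sum_add_distrib]
      exact Finset.sum_congr rfl fun a _ => by ring

/-- First-order optimality at a maximizer of the dual objective. -/
lemma sum_allocCost_le {M : ι → ι → ℝ} (hM : ∀ b c, 0 ≤ M b c) (hsymm : ∀ b c, M b c = M c b)
    {C : ι → ℝ} {s : ι} {e l k : ι → ℝ} (hl : l ∈ multipliers s e) (hk : k ∈ multipliers s e)
    (hmax : ∀ k ∈ multipliers s e, dualValue M C s k ≤ dualValue M C s l)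
    {t : ℝ} (ht0 : 0 < t) (ht1 : t < 1) (hpos : ∀ b, 0 < (1 - t) * l b + t * k b) :
    ∑ a ∈ Finset.univ.erase s, k a * (allocCost M (fun b => (1 - t) * l b + t * k b) s +
      allocCost M (fun b => (1 - t) * l b + t * k b) a + C a) ≤ dualValue M C s l := by
  set j : ι → ℝ := fun b => (1 - t) * l b + t * k b with hj
  have hjm : j ∈ multipliers s e :=
    convex_multipliers s e hl hk (by linarith : (0 : ℝ) ≤ 1 - t) ht0.le (by ring)
  -- With the gradient taken at the positive point `j`, its pairing with `j` is at most the maximum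
  -- while its pairing with `l` is at least the maximum; hence its pairing with `k` is at most the
  -- maximum. Working at `j` avoids differentiating at `l`, which may lie on the boundary.
  have h1 := hmax j hjm
  have h2 := dualValue_le (C := C) hM hsymm hl hpos
  rw [dualValue_eq hjm hpos] at h1
  have h3 : ∑ a ∈ Finset.univ.erase s, j a * (allocCost M j s + allocCost M j a + C a) =
      (1 - t) * ∑ a ∈ Finset.univ.erase s, l a * (allocCost M j s + allocCost M j a + C a) +
      t * ∑ a ∈ Finset.univ.erase s, k a * (allocCost M j s + allocCost M j a + C a) := by
    rw [Finset.mul_sum, Finset.mul_sum, ← Finset.sum_add_distrib]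
    exact Finset.sum_congr rfl fun a _ => by simp only [hj]; ring
  rw [h3] at h1
  have h4 := mul_le_mul_of_nonneg_left h2 (by linarith : (0 : ℝ) ≤ 1 - t)
  change (1 - t) * dualValue M C s l ≤ (1 - t) * ∑ a ∈ Finset.univ.erase s,
    l a * (allocCost M j s + allocCost M j a + C a) at h4
  have h5 : t * ∑ a ∈ Finset.univ.erase s, k a * (allocCost M j s + allocCost M j a + C a) ≤
      t * dualValue M C s l := by linarith
  exact le_of_mul_le_mul_left h5 ht0

/-- If `l b = 0`, moving from `l` towards an interior point makes the cost of `b` grow like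
t^(-1/2), because `l s > 0` and `M b s > 0`; first-order optimality keeps it bounded. -/
lemma pos_of_isMaxOn_dualValue {M : ι → ι → ℝ} (hM : ∀ b c, 0 < M b c)
    (hsymm : ∀ b c, M b c = M c b) {C : ι → ℝ} {s : ι} {e l : ι → ℝ}
    (he : ∀ a, a ≠ s → 0 < e a) (hl : l ∈ multipliers s e)
    (hmax : ∀ k ∈ multipliers s e, dualValue M C s k ≤ dualValue M C s l) (b : ι) : 0 < l b := by
  by_contra hb
  have hb0 : l b = 0 := le_antisymm (not_lt.1 hb) (multipliers_nonneg hl b)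
  have hbs : b ≠ s := by
    rintro rfl
    exact hb (multipliers_pos hl)
  have hbmem : b ∈ Finset.univ.erase s := Finset.mem_erase.2 ⟨hbs, Finset.mem_univ b⟩
  set n : ℝ := ((Finset.univ.erase s).card : ℝ) with hn
  have hn0 : 0 < n := by
    rw [hn]
    exact_mod_cast Finset.card_pos.2 ⟨b, hbmem⟩
  -- The barycentre of the vertices of the multiplier set; all its coordinates are positive.
  set u : ι → ℝ := fun a => if a = s then ∑ c ∈ Finset.univ.erase s, 1 / (e c * n)
    else 1 / (e a * n) with hu
  have huerase : ∀ a ∈ Finset.univ.erase s, u a = 1 / (e a * n) := fun a ha => by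
    simp [hu, Finset.ne_of_mem_erase ha]
  have hupos : ∀ a, a ≠ s → 0 < u a := fun a ha => by
    have := he a ha
    simp only [hu, ha, if_false]
    positivity
  have humem : u ∈ multipliers s e := by
    refine ⟨fun a ha => (hupos a ha).le, ?_, ?_⟩
    · rw [Finset.sum_congr rfl huerase]
      simp [hu]
    · have : ∀ a ∈ Finset.univ.erase s, e a * u a = 1 / n := fun a ha => by
        have := he a (Finset.ne_of_mem_erase ha)
        rw [huerase a ha]
        field_simp
      rw [Finset.sum_congr rfl this, Finset.sum_const, nsmul_eq_mul, ← hn]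
      field_simp
  have hus := multipliers_pos humem
  have hls := multipliers_pos hl
  set m := min (l s) (u s) with hm
  have hm0 : 0 < m := lt_min hls hus
  set B := dualValue M C s l - ∑ a ∈ Finset.univ.erase s, u a * C a with hB
  have key : ∀ t : ℝ, 0 < t → t < 1 → u b * (√m * M b s) ≤ B * (√t * √(u b)) := by
    intro t ht0 ht1
    have hpos : ∀ c, 0 < (1 - t) * l c + t * u c := fun c => by
      have h1 := multipliers_nonneg hl c
      have h2 : 0 < u c := by
        rcases eq_or_ne c s with rfl | h
        · exact hus
        · exact hupos c h
      have : 0 < 1 - t := by linarith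
      positivity
    have h := sum_allocCost_le (fun b c => (hM b c).le) hsymm hl humem hmax ht0 ht1 hpos
    set j : ι → ℝ := fun b => (1 - t) * l b + t * u b with hj
    have h1 : ∑ a ∈ Finset.univ.erase s, u a * allocCost M j a ≤ B := by
      rw [hB, le_sub_iff_add_le, ← Finset.sum_add_distrib]
      refine le_trans (Finset.sum_le_sum fun a ha => ?_) h
      rw [← mul_add]
      refine mul_le_mul_of_nonneg_left ?_ (hupos a (Finset.ne_of_mem_erase ha)).le
      linarith [allocCost_nonneg (fun b c => (hM b c).le) j s]
    have h2 : u b * allocCost M j b ≤ B := le_trans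
      (Finset.single_le_sum (f := fun a => u a * allocCost M j a) (fun a ha =>
        mul_nonneg (hupos a (Finset.ne_of_mem_erase ha)).le
          (allocCost_nonneg (fun b c => (hM b c).le) j a)) hbmem) h1
    have h3 : √(j s) / √(j b) * M b s ≤ allocCost M j b :=
      Finset.single_le_sum (f := fun c => √(j c) / √(j b) * M b c)
        (fun c _ => mul_nonneg (by positivity) (hM b c).le) (Finset.mem_univ s)
    have hjb : j b = t * u b := by simp [hj, hb0]
    have h4 : √m ≤ √(j s) := Real.sqrt_le_sqrt (by
      have := min_le_left (l s) (u s)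
      have := min_le_right (l s) (u s)
      simp only [hj]
      nlinarith)
    have hub := hupos b hbs
    have hsb : 0 < √t * √(u b) := by positivity
    have hsj : √(j b) = √t * √(u b) := by rw [hjb, Real.sqrt_mul ht0.le]
    rw [hsj] at h3
    have h5 : √m / (√t * √(u b)) * M b s ≤ √(j s) / (√t * √(u b)) * M b s := by
      have := (hM b s).le
      gcongr
    have h6 : u b * (√m / (√t * √(u b)) * M b s) ≤ B :=
      le_trans (mul_le_mul_of_nonneg_left (h5.trans h3) hub.le) h2
    calc u b * (√m * M b s) = u b * (√m / (√t * √(u b)) * M b s) * (√t * √(u b)) := by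
          field_simp
      _ ≤ B * (√t * √(u b)) := mul_le_mul_of_nonneg_right h6 hsb.le
  have hlim : Tendsto (fun t : ℝ => B * (√t * √(u b))) (𝓝[>] 0) (𝓝 0) := by
    have : Continuous fun t : ℝ => B * (√t * √(u b)) := by fun_prop
    have h := (this.tendsto 0).mono_left (nhdsWithin_le_nhds (s := Set.Ioi 0))
    simpa using h
  have hle := ge_of_tendsto hlim (b := u b * (√m * M b s)) (by
    filter_upwards [Ioo_mem_nhdsGT (zero_lt_one' ℝ)] with t ht using key t ht.1 ht.2)
  have := hupos b hbs
  have := hM b s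
  have : 0 < u b * (√m * M b s) := by positivity
  linarith

/-- Strong duality for the max problem: there are positive multipliers whose allocation has
all of its objectives bounded by the dual value. -/
theorem exists_multipliers {M : ι → ι → ℝ} (hM : ∀ b c, 0 < M b c)
    (hsymm : ∀ b c, M b c = M c b) (C : ι → ℝ) {s : ι} {e : ι → ℝ}
    (he : ∀ a, a ≠ s → 0 < e a) (hne : ∃ a, a ≠ s) :
    ∃ l ∈ multipliers s e, (∀ b, 0 < l b) ∧
      ∀ a, a ≠ s → (allocCost M l s + allocCost M l a + C a) / e a ≤ dualValue M C s l := by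
  -- Vertices of the multiplier set: at the vertex of `a`, first-order optimality isolates the
  -- constraint of the pair `s`, `a`.
  have hvertex : ∀ a, a ≠ s →
      (fun b => if b = a ∨ b = s then 1 / e a else 0) ∈ multipliers s e := by
    intro a ha
    have hmem : a ∈ Finset.univ.erase s := Finset.mem_erase.2 ⟨ha, Finset.mem_univ a⟩
    have hea := he a ha
    have hE : ∀ b ∈ Finset.univ.erase s,
        (if b = a ∨ b = s then 1 / e a else 0) = if b = a then 1 / e a else 0 := fun b hb => by
      simp [Finset.ne_of_mem_erase hb]
    refine ⟨fun b _ => ?_, ?_, ?_⟩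
    · dsimp only
      split_ifs <;> positivity
    · dsimp only
      rw [Finset.sum_congr rfl hE]
      simp [ha]
    · rw [Finset.sum_congr rfl fun b hb => congrArg (e b * ·) (hE b hb)]
      simp [ha, hea.ne']
  have hcont : Continuous (dualValue M C s) := by
    unfold dualValue allocValue
    fun_prop
  obtain ⟨a₀, ha₀⟩ := hne
  obtain ⟨l, hl, hmax⟩ := (isCompact_multipliers he).exists_isMaxOn ⟨_, hvertex a₀ ha₀⟩
    hcont.continuousOn
  have hpos := pos_of_isMaxOn_dualValue hM hsymm he hl (fun k hk => hmax hk)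
  refine ⟨l, hl, hpos, fun a ha => ?_⟩
  set k : ι → ℝ := fun b => if b = a ∨ b = s then 1 / e a else 0 with hk
  have hkm : k ∈ multipliers s e := hvertex a ha
  have hmem : a ∈ Finset.univ.erase s := Finset.mem_erase.2 ⟨ha, Finset.mem_univ a⟩
  have hea := he a ha
  have key : ∀ t : ℝ, 0 < t → t < 1 →
      (allocCost M (fun b => (1 - t) * l b + t * k b) s +
        allocCost M (fun b => (1 - t) * l b + t * k b) a + C a) / e a ≤ dualValue M C s l := by
    intro t ht0 ht1
    have h := sum_allocCost_le (fun b c => (hM b c).le) hsymm hl hkm (fun k hk => hmax hk) ht0 ht1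
      (fun b => by
        have := hpos b
        have := multipliers_nonneg hkm b
        have : 0 < 1 - t := by linarith
        positivity)
    rw [Finset.sum_eq_single_of_mem a hmem fun b hb hba => by
      simp [hk, hba, Finset.ne_of_mem_erase hb]] at h
    calc _ = _ := by simp only [hk, true_or, if_true]; rw [div_eq_inv_mul, one_div]
      _ ≤ _ := h
  -- Positivity of `l` is what allows the passage t → 0 in the quotients of square roots.
  have hc : ∀ b, ContinuousAt (fun t : ℝ => allocCost M (fun b => (1 - t) * l b + t * k b) b) 0 := by
    intro b
    unfold allocCost
    refine tendsto_finsetSum _ fun c _ => ?_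
    refine ContinuousAt.mul (ContinuousAt.div (by fun_prop) (by fun_prop) ?_) continuousAt_const
    have := Real.sqrt_pos.2 (hpos b)
    simpa using this.ne'
  have hlim : Tendsto (fun t : ℝ => (allocCost M (fun b => (1 - t) * l b + t * k b) s +
      allocCost M (fun b => (1 - t) * l b + t * k b) a + C a) / e a) (𝓝[>] 0)
      (𝓝 ((allocCost M l s + allocCost M l a + C a) / e a)) := by
    have h := ((((hc s).add (hc a)).add (continuousAt_const (y := C a))).div_const (e a)).tendsto.mono_left
      (nhdsWithin_le_nhds (s := Set.Ioi (0 : ℝ)))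
    simpa using h
  exact le_of_tendsto hlim (by
    filter_upwards [Ioo_mem_nhdsGT (zero_lt_one' ℝ)] with t ht using key t ht.1 ht.2)

/-! ### Reduction of general contrasts to pairs. -/

/-- The worst pairwise comparison with the best arm is not improved by general contrasts. -/
theorem exists_contrast_lower_bound {K : ℕ} {S : Fin K → Fin K → ℝ} (hS : ∀ b c, S b c = S c b)
    (hpos : ∀ w, 0 ≤ quadForm S w) {mu : Fin K → ℝ} {s a : Fin K} (ha : a ≠ s)
    (hmu : mu a < mu s)
    (hz : 0 < quadForm S (Pi.single s 1 - Pi.single a 1)) :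
    ∃ a', a' ≠ s ∧ ∀ w ∈ contrastWeights a', 0 ≤ ∑ b, w b * mu b →
      quadForm S (Pi.single s 1 - Pi.single a 1) / (mu s - mu a) ^ 2 * (∑ b, w b * mu b) ^ 2 ≤
        quadForm S w := by
  set z : Fin K → ℝ := Pi.single s 1 - Pi.single a 1 with hzdef
  have hd : 0 < mu s - mu a := by linarith
  set y : Fin K → ℝ := fun b => ∑ c, S b c * z c with hy
  -- The multiple of `S z` subtracted from `mu` is the one that makes arms `s` and `a` tie.
  set nu : Fin K → ℝ := fun b => mu b - y b * ((mu s - mu a) / quadForm S z) with hnu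
  have hyz : y s - y a = quadForm S z := by
    have : quadForm S z = ∑ b, z b * y b := by
      simp only [quadForm, hy, Finset.mul_sum]
      exact Finset.sum_congr rfl fun b _ => Finset.sum_congr rfl fun c _ => by ring
    rw [this]
    simp [hzdef, sub_mul, Finset.sum_sub_distrib, Pi.single_apply]
  have hnueq : nu a = nu s := by
    have : (y s - y a) * ((mu s - mu a) / quadForm S z) = mu s - mu a := by
      rw [hyz]; field_simp
    simp only [hnu]
    linarith
  -- The tie makes a maximizer of `nu` off `s` a maximizer over all arms. Every `w` in
  -- `contrastWeights a'` compares an average of `nu` with its maximum, so it pairs nonpositively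
  -- with `nu`.
  obtain ⟨a', ha', hmax⟩ := Finset.exists_max_image (Finset.univ.erase s) nu
    ⟨a, Finset.mem_erase.2 ⟨ha, Finset.mem_univ a⟩⟩
  have hmax' : ∀ b, nu b ≤ nu a' := fun b => by
    rcases eq_or_ne b s with rfl | h
    · rw [← hnueq]
      exact hmax a (Finset.mem_erase.2 ⟨ha, Finset.mem_univ a⟩)
    · exact hmax b (Finset.mem_erase.2 ⟨h, Finset.mem_univ b⟩)
  refine ⟨a', Finset.ne_of_mem_erase ha', fun w ⟨hw1, hw2, hw3⟩ hw => ?_⟩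
  have hwnu : ∑ b, w b * nu b ≤ 0 := by
    rw [← Finset.add_sum_erase _ _ (Finset.mem_univ a'), hw1]
    have : ∑ b ∈ Finset.univ.erase a', w b * nu b ≤ ∑ b ∈ Finset.univ.erase a', w b * nu a' :=
      Finset.sum_le_sum fun b hb =>
        mul_le_mul_of_nonneg_left (hmax' b) (hw2 b (Finset.ne_of_mem_erase hb))
    rw [← Finset.sum_mul, hw3] at this
    linarith
  have hle : ∑ b, w b * mu b ≤ (∑ b, w b * y b) * ((mu s - mu a) / quadForm S z) := by
    have : ∑ b, w b * nu b =
        ∑ b, w b * mu b - (∑ b, w b * y b) * ((mu s - mu a) / quadForm S z) := by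
      rw [Finset.sum_mul, ← Finset.sum_sub_distrib]
      exact Finset.sum_congr rfl fun b _ => by simp only [hnu]; ring
    linarith
  have hcs := sq_bilin_le_quadForm_mul hS hpos hz w
  -- The sign condition on the mean of `w` is what permits squaring.
  have hsq : (∑ b, w b * mu b) ^ 2 ≤
      (∑ b, w b * y b) ^ 2 * ((mu s - mu a) / quadForm S z) ^ 2 := by
    rw [← mul_pow]
    exact pow_le_pow_left₀ hw hle 2
  calc quadForm S z / (mu s - mu a) ^ 2 * (∑ b, w b * mu b) ^ 2
      ≤ quadForm S z / (mu s - mu a) ^ 2 *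
        ((quadForm S w * quadForm S z) * ((mu s - mu a) / quadForm S z) ^ 2) := by
        refine mul_le_mul_of_nonneg_left (hsq.trans ?_) (by positivity)
        exact mul_le_mul_of_nonneg_right hcs (by positivity)
    _ = quadForm S w := by field_simp

end FiniteDimensional

end BAI

namespace BAI

/-! ### Conditional moments of the scores. -/

section Model

variable {X : Type*} [MeasurableSpace X] {K : ℕ}

/-- Arm by arm, an almost surely convergent bounded sequence of regressions has a bounded limit. -/
lemma RegressionConverges.exists_bound {Ω : Type*} [MeasurableSpace Ω] {P : Measure Ω} [NeZero P]
    {PX : Measure X} {gseq : ℕ → Ω → X → Fin K → ℝ} {ginf : X → Fin K → ℝ}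
    (h : RegressionConverges P PX gseq ginf) :
    ∃ B : ℝ, ∀ᵐ x ∂PX, ∀ a, |ginf x a| ≤ B := by
  obtain ⟨hm, hg, hae⟩ := h
  obtain ⟨ω, hω, B, hB⟩ := hae.exists
  refine ⟨B, ae_all_iff.2 fun a => ?_⟩
  have hmeas : TendstoInMeasure PX (fun t x => gseq t ω x a) atTop (fun x => ginf x a) :=
    tendstoInMeasure_of_tendsto_eLpNorm two_ne_zero
      (fun t => (hm t ω a).aestronglyMeasurable) (hg a).aestronglyMeasurable (hω a)
  obtain ⟨ns, -, hns⟩ := hmeas.exists_seq_tendsto_ae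
  filter_upwards [hns] with x hx
  exact le_of_tendsto hx.abs (Eventually.of_forall fun i => hB _ _ _)

/-- A bounded model with bounded limiting regression functions and positive variances. -/
structure IsRegular (PX : Measure X) (κ : Kernel (X × Fin K) ℝ) (ginf : X → Fin K → ℝ) :
    Prop where
  measurable : ∀ a, Measurable fun x => ginf x a
  bounded : ∃ B : ℝ, ∀ᵐ x ∂PX, ∀ a, |ginf x a| ≤ B ∧ ∀ᵐ y ∂(κ (x, a)), |y| ≤ B
  condVar_pos : ∀ᵐ x ∂PX, ∀ a, 0 < condVar κ x a

lemma isRegular {Ω : Type*} [MeasurableSpace Ω] {P : Measure Ω} [NeZero P]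
    {PX : Measure X} {κ : Kernel (X × Fin K) ℝ}
    {gseq : ℕ → Ω → X → Fin K → ℝ} {ginf : X → Fin K → ℝ}
    (hvar : NondegenerateVariances PX κ) (hbdd : BoundedOutcomes PX κ)
    (h : RegressionConverges P PX gseq ginf) : IsRegular PX κ ginf := by
  refine ⟨h.2.1, ?_, ae_all_iff.2 hvar⟩
  obtain ⟨B, hB⟩ := h.exists_bound
  obtain ⟨B', hB'⟩ := hbdd
  refine ⟨max B B', ?_⟩
  filter_upwards [hB, ae_all_iff.2 hB'] with x h1 h2 a
  refine ⟨(h1 a).trans (le_max_left _ _), ?_⟩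
  filter_upwards [h2 a] with y hy using hy.le.trans (le_max_right _ _)

section Kernel

lemma measurable_condMean_uncurry (κ : Kernel (X × Fin K) ℝ) :
    Measurable fun p : X × Fin K => condMean κ p.1 p.2 :=
  (stronglyMeasurable_id.integral_kernel (κ := κ)).measurable

lemma measurable_condMean (κ : Kernel (X × Fin K) ℝ) (a : Fin K) : Measurable fun x => condMean κ x a :=
  (measurable_condMean_uncurry κ).comp (measurable_id.prodMk measurable_const)

variable (κ : Kernel (X × Fin K) ℝ) [IsMarkovKernel κ]

lemma measurable_condVar (a : Fin K) : Measurable fun x => condVar κ x a := by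
  have h : StronglyMeasurable fun p : X × Fin K =>
      ∫ y, (y - condMean κ p.1 p.2) ^ 2 ∂(κ p) := by
    refine StronglyMeasurable.integral_kernel_prod_right ?_
    have := measurable_condMean_uncurry κ
    exact Measurable.stronglyMeasurable (by unfold Function.uncurry; fun_prop)
  exact h.measurable.comp (measurable_id.prodMk measurable_const)

lemma measurable_totalVar {ginf : X → Fin K → ℝ} (hg : ∀ a, Measurable fun x => ginf x a)
    (a : Fin K) : Measurable fun x => totalVar κ ginf x a :=
  (measurable_condVar κ a).add (((hg a).sub (measurable_condMean κ a)).pow_const 2)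

lemma lintegral_jointLaw {PX : Measure X} [SFinite PX] {π : X → Fin K → ℝ}
    (hπ : ∀ a, Measurable fun x => π x a) {F : X × Fin K × ℝ → ℝ≥0∞} (hF : Measurable F) :
    ∫⁻ z, F z ∂(jointLaw PX κ π) =
      ∫⁻ x, ∑ a, ENNReal.ofReal (π x a) * ∫⁻ y, F (x, a, y) ∂(κ (x, a)) ∂PX := by
  have hmap : ∀ a : Fin K, Measurable fun p : X × ℝ => (p.1, a, p.2) := fun a => by fun_prop
  have hinner : ∀ a : Fin K, Measurable fun x => ∫⁻ y, F (x, a, y) ∂(κ (x, a)) := fun a =>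
    Measurable.lintegral_kernel_prod_right
      (κ := κ.comap (fun x : X => (x, a)) (measurable_id.prodMk measurable_const))
      (f := fun x y => F (x, a, y)) (hF.comp (hmap a))
  rw [jointLaw, lintegral_finsetSum_measure, lintegral_finsetSum]
  · refine Finset.sum_congr rfl fun a _ => ?_
    rw [lintegral_map hF (hmap a), Measure.lintegral_compProd (f := fun p : X × ℝ => F (p.1, a, p.2)) (hF.comp (hmap a)),
      lintegral_withDensity_eq_lintegral_mul _ (hπ a).ennreal_ofReal]
    · rfl
    · exact hinner a
  · exact fun a _ => (hπ a).ennreal_ofReal.mul (hinner a)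

end Kernel

lemma integrable_sq_affine {ν : Measure ℝ} [IsProbabilityMeasure ν] {B : ℝ}
    (hB : ∀ᵐ y ∂ν, |y| ≤ B) (h c g : ℝ) : Integrable (fun y => (h + c * (y - g)) ^ 2) ν := by
  refine Integrable.of_bound (C := (|h| + |c| * (B + |g|)) ^ 2)
    (by fun_prop) ?_
  filter_upwards [hB] with y hy
  rw [Real.norm_eq_abs, abs_pow]
  refine pow_le_pow_left₀ (abs_nonneg _) ?_ 2
  refine (abs_add_le _ _).trans ?_
  rw [abs_mul]
  gcongr
  exact (abs_sub _ _).trans (by gcongr)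

/-- Bias-variance decomposition: expand around the mean of `ν`, where the linear term integrates to
zero. -/
lemma integral_sq_affine {ν : Measure ℝ} [IsProbabilityMeasure ν] {B : ℝ}
    (hB : ∀ᵐ y ∂ν, |y| ≤ B) (h c g : ℝ) :
    ∫ y, (h + c * (y - g)) ^ 2 ∂ν = h ^ 2 + 2 * h * c * (∫ y, y ∂ν - g) +
      c ^ 2 * (∫ y, (y - ∫ y, y ∂ν) ^ 2 ∂ν + (g - ∫ y, y ∂ν) ^ 2) := by
  set m := ∫ y, y ∂ν with hm
  have h1 : Integrable (fun y : ℝ => y) ν :=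
    Integrable.of_bound (C := B) (by fun_prop) (by simpa using hB)
  have h2 : Integrable (fun y : ℝ => (y - m) ^ 2) ν := by
    simpa using integrable_sq_affine hB 0 1 m
  have : ∀ y : ℝ, (h + c * (y - g)) ^ 2 =
      c ^ 2 * (y - m) ^ 2 + (2 * c * (h + c * (m - g)) * (y - m) + (h + c * (m - g)) ^ 2) :=
    fun y => by ring
  rw [integral_congr_ae (Eventually.of_forall this)]
  have h3 : Integrable (fun y : ℝ => y - m) ν := h1.sub (integrable_const m)
  have h4 : Integrable (fun y : ℝ => 2 * c * (h + c * (m - g)) * (y - m) +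
      (h + c * (m - g)) ^ 2) ν := (h3.const_mul _).add (integrable_const _)
  rw [integral_add (h2.const_mul _) h4,
    integral_add (h3.const_mul _) (integrable_const _), integral_const_mul, integral_const_mul,
    integral_sub h1 (integrable_const _)]
  simp only [integral_const, probReal_univ, smul_eq_mul, one_mul]
  rw [← hm]
  ring

lemma condMean_abs_le {κ : Kernel (X × Fin K) ℝ} [IsMarkovKernel κ] {B : ℝ} {x : X} {a : Fin K}
    (hB : ∀ᵐ y ∂(κ (x, a)), |y| ≤ B) : |condMean κ x a| ≤ B := by
  have := norm_integral_le_of_norm_le_const (μ := κ (x, a)) (f := fun y => y) (C := B)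
    (by simpa using hB)
  simpa [condMean] using this

lemma totalVar_eq {κ : Kernel (X × Fin K) ℝ} [IsMarkovKernel κ] {ginf : X → Fin K → ℝ}
    {B : ℝ} {x : X} {a : Fin K} (hB : ∀ᵐ y ∂(κ (x, a)), |y| ≤ B) :
    totalVar κ ginf x a = ∫ y, (y - ginf x a) ^ 2 ∂(κ (x, a)) := by
  have := integral_sq_affine hB 0 1 (ginf x a)
  simp only [zero_add, one_mul, one_pow] at this
  rw [this, totalVar, condVar]
  simp [condMean]

lemma totalVar_le {κ : Kernel (X × Fin K) ℝ} [IsMarkovKernel κ] {ginf : X → Fin K → ℝ}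
    {B : ℝ} {x : X} {a : Fin K} (hB : ∀ᵐ y ∂(κ (x, a)), |y| ≤ B) (hg : |ginf x a| ≤ B) :
    totalVar κ ginf x a ≤ (B + B) ^ 2 := by
  rw [totalVar_eq hB]
  refine (le_abs_self _).trans ?_
  have := norm_integral_le_of_norm_le_const (μ := κ (x, a)) (f := fun y => (y - ginf x a) ^ 2)
    (C := (B + B) ^ 2) (by
      filter_upwards [hB] with y hy
      rw [Real.norm_eq_abs, abs_pow]
      exact pow_le_pow_left₀ (abs_nonneg _) ((abs_sub _ _).trans (add_le_add hy hg)) 2)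
  simpa using this

/-- The conditional second moment, given the context, of the centered contrast `w` of scores. -/
noncomputable def condMoment (PX : Measure X) (κ : Kernel (X × Fin K) ℝ) (ginf : X → Fin K → ℝ)
    (π : X → Fin K → ℝ) (w : Fin K → ℝ) (x : X) : ℝ :=
  ∑ b, w b ^ 2 * (totalVar κ ginf x b / π x b) +
    ((∑ b, w b * (condMean κ x b - armMean PX κ b)) ^ 2 -
      (∑ b, w b * (ginf x b - condMean κ x b)) ^ 2)

lemma score_contrast (PX : Measure X) (κ : Kernel (X × Fin K) ℝ) (ginf : X → Fin K → ℝ)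
    (π : X → Fin K → ℝ) (w : Fin K → ℝ) (x : X) (a : Fin K) (y : ℝ) :
    ∑ b, w b * (score ginf π b (x, a, y) - armMean PX κ b) =
      ∑ b, w b * (ginf x b - armMean PX κ b) + w a / π x a * (y - ginf x a) := by
  have : ∀ b, w b * (score ginf π b (x, a, y) - armMean PX κ b) =
      w b * (ginf x b - armMean PX κ b) +
        if a = b then w b / π x b * (y - ginf x b) else 0 := fun b => by
    simp only [score]
    split_ifs <;> ring
  simp_rw [this, Finset.sum_add_distrib]
  simp

/-- The inverse weight cancels the propensity in the cross term, which corrects the regression bias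
in the mean; the squared term leaves total variance over propensity. -/
lemma sum_lintegral_score_sq {PX : Measure X} {κ : Kernel (X × Fin K) ℝ} [IsMarkovKernel κ]
    {ginf : X → Fin K → ℝ} {π : X → Fin K → ℝ} {w : Fin K → ℝ} {x : X} {B : ℝ}
    (hB : ∀ a, ∀ᵐ y ∂(κ (x, a)), |y| ≤ B) (h0 : ∀ a, 0 ≤ π x a) (h1 : ∑ a, π x a = 1)
    (hw : ∀ b, w b ≠ 0 → 0 < π x b) :
    ∑ a, ENNReal.ofReal (π x a) * ∫⁻ y, ENNReal.ofReal
        ((∑ b, w b * (score ginf π b (x, a, y) - armMean PX κ b)) ^ 2) ∂(κ (x, a)) =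
      ENNReal.ofReal (condMoment PX κ ginf π w x) := by
  set h := ∑ b, w b * (ginf x b - armMean PX κ b) with hh
  have hterm : ∀ a, ENNReal.ofReal (π x a) * ∫⁻ y, ENNReal.ofReal
        ((∑ b, w b * (score ginf π b (x, a, y) - armMean PX κ b)) ^ 2) ∂(κ (x, a)) =
      ENNReal.ofReal (π x a * ∫ y, (h + w a / π x a * (y - ginf x a)) ^ 2 ∂(κ (x, a))) := by
    intro a
    simp_rw [score_contrast, ← hh]
    rw [ENNReal.ofReal_mul (h0 a), ofReal_integral_eq_lintegral_ofReal
      (integrable_sq_affine (hB a) _ _ _) (Eventually.of_forall fun y => sq_nonneg _)]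
  simp_rw [hterm]
  rw [← ENNReal.ofReal_sum_of_nonneg fun a _ =>
    mul_nonneg (h0 a) (integral_nonneg fun y => sq_nonneg _)]
  congr 1
  have hval : ∀ a, π x a * ∫ y, (h + w a / π x a * (y - ginf x a)) ^ 2 ∂(κ (x, a)) =
      π x a * h ^ 2 + 2 * h * (w a * (condMean κ x a - ginf x a)) +
        w a ^ 2 * (totalVar κ ginf x a / π x a) := by
    intro a
    rw [integral_sq_affine (hB a)]
    change π x a * (h ^ 2 + 2 * h * (w a / π x a) * (condMean κ x a - ginf x a) +
      (w a / π x a) ^ 2 * totalVar κ ginf x a) = _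
    by_cases hwa : w a = 0
    · simp [hwa]
    · have := hw a hwa
      field_simp
  simp_rw [hval, Finset.sum_add_distrib, ← Finset.sum_mul, ← Finset.mul_sum, h1]
  have hmean : ∑ b, w b * (condMean κ x b - armMean PX κ b) =
      h + ∑ a, w a * (condMean κ x a - ginf x a) := by
    rw [hh, ← Finset.sum_add_distrib]
    exact Finset.sum_congr rfl fun b _ => by ring
  have hres : ∑ b, w b * (ginf x b - condMean κ x b) =
      - ∑ a, w a * (condMean κ x a - ginf x a) := by
    rw [← Finset.sum_neg_distrib]
    exact Finset.sum_congr rfl fun b _ => by ring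
  rw [condMoment, hmean, hres]
  ring

/-- The negative residual term in `condMoment` is absorbed by the squared bias inside `totalVar`, by
Cauchy-Schwarz with weights `π x b`. This is the source of all strict positivity below. -/
lemma sum_condVar_le_condMoment {PX : Measure X} {κ : Kernel (X × Fin K) ℝ}
    {ginf : X → Fin K → ℝ} {π : X → Fin K → ℝ} {w : Fin K → ℝ} {x : X}
    (h0 : ∀ a, 0 ≤ π x a) (h1 : ∑ a, π x a = 1) (hw : ∀ b, w b ≠ 0 → 0 < π x b) :
    ∑ b, w b ^ 2 * (condVar κ x b / π x b) ≤ condMoment PX κ ginf π w x := by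
  have hcs : (∑ b, w b * (ginf x b - condMean κ x b)) ^ 2 ≤
      (∑ b, π x b) * ∑ b, w b ^ 2 * ((ginf x b - condMean κ x b) ^ 2 / π x b) := by
    refine Finset.sum_sq_le_sum_mul_sum_of_sq_le_mul _ (fun b _ => h0 b)
      (fun b _ => mul_nonneg (sq_nonneg _) (div_nonneg (sq_nonneg _) (h0 b))) fun b _ => le_of_eq ?_
    by_cases hwb : w b = 0
    · simp [hwb]
    · have := hw b hwb
      field_simp
  rw [h1, one_mul] at hcs
  have hsplit : ∑ b, w b ^ 2 * (totalVar κ ginf x b / π x b) =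
      ∑ b, w b ^ 2 * (condVar κ x b / π x b) +
        ∑ b, w b ^ 2 * ((ginf x b - condMean κ x b) ^ 2 / π x b) := by
    rw [← Finset.sum_add_distrib]
    exact Finset.sum_congr rfl fun b _ => by rw [totalVar]; ring
  rw [condMoment, hsplit]
  linarith [sq_nonneg (∑ b, w b * (condMean κ x b - armMean PX κ b))]

lemma measurable_condMoment {PX : Measure X} {κ : Kernel (X × Fin K) ℝ} [IsMarkovKernel κ]
    {ginf : X → Fin K → ℝ} (hg : ∀ a, Measurable fun x => ginf x a) {π : X → Fin K → ℝ}
    (hπ : ∀ a, Measurable fun x => π x a) (w : Fin K → ℝ) :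
    Measurable (condMoment PX κ ginf π w) := by
  unfold condMoment
  have h1 := measurable_totalVar κ hg
  have h2 := measurable_condMean κ
  fun_prop

variable {PX : Measure X} {κ : Kernel (X × Fin K) ℝ} [IsMarkovKernel κ]
  {ginf π : X → Fin K → ℝ}

lemma lintegral_score_sq [SFinite PX] (hr : IsRegular PX κ ginf) (hπ : IsPolicy PX π)
    {w : Fin K → ℝ} (hw : ∀ b, w b ≠ 0 → ∀ᵐ x ∂PX, 0 < π x b) :
    ∫⁻ z, ENNReal.ofReal ((∑ b, w b * (score ginf π b z - armMean PX κ b)) ^ 2)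
      ∂(jointLaw PX κ π) = ∫⁻ x, ENNReal.ofReal (condMoment PX κ ginf π w x) ∂PX := by
  have hmeas : Measurable fun z : X × Fin K × ℝ =>
      ENNReal.ofReal ((∑ b, w b * (score ginf π b z - armMean PX κ b)) ^ 2) := by
    have hscore : ∀ b, Measurable (score ginf π b) := fun b => by
      have h1 : Measurable fun z : X × Fin K × ℝ => ginf z.1 b := (hr.measurable b).comp (by fun_prop)
      have h2 : Measurable fun z : X × Fin K × ℝ => π z.1 b := (hπ.measurable b).comp (by fun_prop)
      refine h1.add (Measurable.div (Measurable.ite ?_ ?_ measurable_const) h2)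
      · exact (measurableSet_singleton b).preimage (by fun_prop)
      · exact Measurable.sub (by fun_prop) h1
    fun_prop
  rw [lintegral_jointLaw κ hπ.measurable hmeas]
  obtain ⟨B, hB⟩ := hr.bounded
  have hw' : ∀ᵐ x ∂PX, ∀ b, w b ≠ 0 → 0 < π x b := ae_all_iff.2 fun b => by
    by_cases hb : w b = 0
    · simp [hb]
    · filter_upwards [hw b hb] with x hx _ using hx
  refine lintegral_congr_ae ?_
  filter_upwards [hB, hπ.nonneg, hπ.sum_eq_one, hw'] with x h1 h2 h3 h4
  exact sum_lintegral_score_sq (fun a => (h1 a).2) h2 h3 h4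

end Model

end BAI

namespace BAI

/-! ### The objective as a maximum of pairwise values. -/

section Objective

variable {X : Type*} [MeasurableSpace X] {K : ℕ}

/-- The part of the second moment of the scores that does not depend on the policy. -/
noncomputable def crossMoment (PX : Measure X) (κ : Kernel (X × Fin K) ℝ)
    (ginf : X → Fin K → ℝ) (b c : Fin K) : ℝ :=
  ∫ x, ((condMean κ x b - armMean PX κ b) * (condMean κ x c - armMean PX κ c) -
    (ginf x b - condMean κ x b) * (ginf x c - condMean κ x c)) ∂PX

/-- The integrated total variance of arm `b` weighted by the inverse propensity. -/
noncomputable def armCost (PX : Measure X) (κ : Kernel (X × Fin K) ℝ)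
    (ginf π : X → Fin K → ℝ) (b : Fin K) : ℝ :=
  ∫ x, totalVar κ ginf x b / π x b ∂PX

/-- The second-moment matrix of the scores. -/
noncomputable def scoreMoment (PX : Measure X) (κ : Kernel (X × Fin K) ℝ)
    (ginf π : X → Fin K → ℝ) (b c : Fin K) : ℝ :=
  (if b = c then armCost PX κ ginf π b else 0) + crossMoment PX κ ginf b c

/-- A policy with positive propensities and finite costs. -/
structure IsFinitePolicy (PX : Measure X) (κ : Kernel (X × Fin K) ℝ)
    (ginf π : X → Fin K → ℝ) : Prop extends IsPolicy PX π where
  pos : ∀ᵐ x ∂PX, ∀ b, 0 < π x b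
  integrable : ∀ b, Integrable (fun x => totalVar κ ginf x b / π x b) PX

lemma crossMoment_comm (PX : Measure X) (κ : Kernel (X × Fin K) ℝ) (ginf : X → Fin K → ℝ)
    (b c : Fin K) : crossMoment PX κ ginf b c = crossMoment PX κ ginf c b := by
  unfold crossMoment
  congr 1
  ext x
  ring

lemma scoreMoment_comm (PX : Measure X) (κ : Kernel (X × Fin K) ℝ) (ginf π : X → Fin K → ℝ)
    (b c : Fin K) : scoreMoment PX κ ginf π b c = scoreMoment PX κ ginf π c b := by
  unfold scoreMoment
  rw [crossMoment_comm]
  by_cases h : b = c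
  · rw [h]
  · rw [if_neg h, if_neg (Ne.symm h)]

lemma condMoment_eq (PX : Measure X) (κ : Kernel (X × Fin K) ℝ) (ginf π : X → Fin K → ℝ)
    (w : Fin K → ℝ) (x : X) :
    condMoment PX κ ginf π w x = ∑ b, w b ^ 2 * (totalVar κ ginf x b / π x b) +
      ∑ b, ∑ c, w b * w c *
        ((condMean κ x b - armMean PX κ b) * (condMean κ x c - armMean PX κ c) -
          (ginf x b - condMean κ x b) * (ginf x c - condMean κ x c)) := by
  rw [condMoment, sq (∑ b, w b * (condMean κ x b - armMean PX κ b)),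
    sq (∑ b, w b * (ginf x b - condMean κ x b)), Finset.sum_mul_sum, Finset.sum_mul_sum,
    ← Finset.sum_sub_distrib]
  congr 1
  refine Finset.sum_congr rfl fun b _ => ?_
  rw [← Finset.sum_sub_distrib]
  exact Finset.sum_congr rfl fun c _ => by ring

variable {PX : Measure X} {κ : Kernel (X × Fin K) ℝ} {ginf π : X → Fin K → ℝ}

lemma IsRegular.totalVar_pos (hr : IsRegular PX κ ginf) :
    ∀ᵐ x ∂PX, ∀ a, 0 < totalVar κ ginf x a := by
  filter_upwards [hr.condVar_pos] with x hx a
  have := hx a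
  unfold totalVar
  positivity

lemma IsPolicy.condMoment_pos (hr : IsRegular PX κ ginf) (hπ : IsPolicy PX π) {w : Fin K → ℝ}
    (hw0 : w ≠ 0) (hw : ∀ b, w b ≠ 0 → ∀ᵐ x ∂PX, 0 < π x b) :
    ∀ᵐ x ∂PX, 0 < condMoment PX κ ginf π w x := by
  have hw' : ∀ᵐ x ∂PX, ∀ b, w b ≠ 0 → 0 < π x b := ae_all_iff.2 fun b => by
    by_cases hb : w b = 0
    · simp [hb]
    · filter_upwards [hw b hb] with x hx _ using hx
  obtain ⟨a, ha⟩ := Function.ne_iff.1 hw0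
  rw [Pi.zero_apply] at ha
  filter_upwards [hπ.nonneg, hπ.sum_eq_one, hw', hr.condVar_pos] with x h0 h1 h2 h3
  refine lt_of_lt_of_le ?_ (sum_condVar_le_condMoment h0 h1 h2)
  refine Finset.sum_pos' (fun b _ => mul_nonneg (sq_nonneg _) (div_nonneg (h3 b).le (h0 b)))
    ⟨a, Finset.mem_univ a, ?_⟩
  have := h2 a ha
  have := h3 a
  positivity

/-- The policy-independent part of the second moment of the contrast of `s` and `a`. -/
noncomputable def pairMoment (PX : Measure X) (κ : Kernel (X × Fin K) ℝ)
    (ginf : X → Fin K → ℝ) (s a : Fin K) : ℝ :=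
  crossMoment PX κ ginf s s - crossMoment PX κ ginf s a - crossMoment PX κ ginf a s +
    crossMoment PX κ ginf a a

lemma quadForm_scoreMoment_pair {s a : Fin K} (ha : a ≠ s) :
    quadForm (scoreMoment PX κ ginf π) (Pi.single s 1 - Pi.single a 1) =
      armCost PX κ ginf π s + armCost PX κ ginf π a + pairMoment PX κ ginf s a := by
  simp only [quadForm, Pi.sub_apply, sub_mul, mul_sub, Finset.sum_sub_distrib, Pi.single_apply]
  simp [scoreMoment, ha, ha.symm, pairMoment]
  ring

variable [IsMarkovKernel κ]

lemma IsRegular.exists_totalVar_le (hr : IsRegular PX κ ginf) :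
    ∃ B : ℝ, ∀ᵐ x ∂PX, ∀ a, totalVar κ ginf x a ≤ B := by
  obtain ⟨B, hB⟩ := hr.bounded
  refine ⟨(B + B) ^ 2, ?_⟩
  filter_upwards [hB] with x hx a using totalVar_le (hx a).2 (hx a).1

lemma IsRegular.exists_residual_le (hr : IsRegular PX κ ginf) :
    ∃ B : ℝ, 0 ≤ B ∧ ∀ᵐ x ∂PX, ∀ a, |condMean κ x a - armMean PX κ a| ≤ B ∧
      |ginf x a - condMean κ x a| ≤ B := by
  obtain ⟨B, hB⟩ := hr.bounded
  refine ⟨max 0 (max (B + ∑ a, |armMean PX κ a|) (B + B)), le_max_left _ _, ?_⟩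
  filter_upwards [hB] with x hx a
  have h1 := condMean_abs_le (hx a).2
  have h2 : |armMean PX κ a| ≤ ∑ a, |armMean PX κ a| :=
    Finset.single_le_sum (f := fun a => |armMean PX κ a|) (fun a _ => abs_nonneg _)
      (Finset.mem_univ a)
  exact ⟨(abs_sub _ _).trans ((add_le_add h1 h2).trans
      ((le_max_left _ _).trans (le_max_right _ _))),
    (abs_sub _ _).trans ((add_le_add (hx a).1 h1).trans
      ((le_max_right _ _).trans (le_max_right _ _)))⟩

variable [IsProbabilityMeasure PX]

lemma IsRegular.integrable_crossMoment (hr : IsRegular PX κ ginf) (b c : Fin K) :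
    Integrable (fun x => (condMean κ x b - armMean PX κ b) * (condMean κ x c - armMean PX κ c) -
      (ginf x b - condMean κ x b) * (ginf x c - condMean κ x c)) PX := by
  obtain ⟨B, hB0, hB⟩ := hr.exists_residual_le
  have h1 := measurable_condMean κ
  have h2 := hr.measurable
  refine Integrable.of_bound (C := B * B + B * B)
    (Measurable.aestronglyMeasurable (by fun_prop)) ?_
  filter_upwards [hB] with x hx
  rw [Real.norm_eq_abs]
  refine (abs_sub _ _).trans ?_
  rw [abs_mul, abs_mul]
  exact add_le_add (mul_le_mul (hx b).1 (hx c).1 (abs_nonneg _) hB0)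
    (mul_le_mul (hx b).2 (hx c).2 (abs_nonneg _) hB0)

lemma IsFinitePolicy.integrable_condMoment (hr : IsRegular PX κ ginf)
    (hπ : IsFinitePolicy PX κ ginf π) (w : Fin K → ℝ) :
    Integrable (condMoment PX κ ginf π w) PX := by
  rw [funext (condMoment_eq PX κ ginf π w)]
  exact (integrable_finsetSum _ fun b _ => (hπ.integrable b).const_mul _).add
    (integrable_finsetSum _ fun b _ => integrable_finsetSum _ fun c _ =>
      (hr.integrable_crossMoment b c).const_mul _)

lemma IsFinitePolicy.integral_condMoment (hr : IsRegular PX κ ginf)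
    (hπ : IsFinitePolicy PX κ ginf π) (w : Fin K → ℝ) :
    ∫ x, condMoment PX κ ginf π w x ∂PX = quadForm (scoreMoment PX κ ginf π) w := by
  simp_rw [condMoment_eq]
  rw [integral_add
    (integrable_finsetSum _ fun b _ => (hπ.integrable b).const_mul _)
    (integrable_finsetSum _ fun b _ => integrable_finsetSum _ fun c _ =>
      (hr.integrable_crossMoment b c).const_mul _),
    integral_finsetSum _ fun b _ => (hπ.integrable b).const_mul _,
    integral_finsetSum _ fun b _ => integrable_finsetSum _ fun c _ =>
      (hr.integrable_crossMoment b c).const_mul _]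
  simp_rw [integral_const_mul]
  rw [quadForm, ← Finset.sum_add_distrib]
  refine Finset.sum_congr rfl fun b _ => ?_
  rw [integral_finsetSum _ fun c _ => (hr.integrable_crossMoment b c).const_mul _]
  simp_rw [integral_const_mul, scoreMoment, mul_add, Finset.sum_add_distrib]
  congr 1
  simp [armCost, sq]

lemma IsFinitePolicy.quadForm_pos (hr : IsRegular PX κ ginf) (hπ : IsFinitePolicy PX κ ginf π)
    {w : Fin K → ℝ} (hw0 : w ≠ 0) : 0 < quadForm (scoreMoment PX κ ginf π) w := by
  have hpos := hπ.toIsPolicy.condMoment_pos hr hw0 fun b _ => by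
    filter_upwards [hπ.pos] with x hx using hx b
  have hnn : 0 ≤ᵐ[PX] condMoment PX κ ginf π w := by
    filter_upwards [hpos] with x hx using hx.le
  rw [← hπ.integral_condMoment hr]
  refine lt_of_le_of_ne (integral_nonneg_of_ae hnn) fun h => ?_
  have h0 := (integral_eq_zero_iff_of_nonneg_ae hnn (hπ.integrable_condMoment hr w)).1 h.symm
  obtain ⟨x, hx, hx'⟩ := (hpos.and h0).exists
  rw [hx'] at hx
  exact lt_irrefl _ hx

lemma IsFinitePolicy.quadForm_nonneg (hr : IsRegular PX κ ginf) (hπ : IsFinitePolicy PX κ ginf π)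
    (w : Fin K → ℝ) : 0 ≤ quadForm (scoreMoment PX κ ginf π) w := by
  by_cases hw : w = 0
  · simp [hw, quadForm]
  · exact (hπ.quadForm_pos hr hw).le

lemma IsFinitePolicy.invSNRSq_eq (hr : IsRegular PX κ ginf) (hπ : IsFinitePolicy PX κ ginf π)
    (w : Fin K → ℝ) : invSNRSq PX κ ginf π w =
      ENNReal.ofReal (quadForm (scoreMoment PX κ ginf π) w) /
        ENNReal.ofReal ((∑ b, w b * armMean PX κ b) ^ 2) := by
  have hpos : ∀ b, w b ≠ 0 → ∀ᵐ x ∂PX, 0 < π x b := fun b _ => by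
    filter_upwards [hπ.pos] with x hx using hx b
  rw [invSNRSq, if_pos hpos, lintegral_score_sq hr hπ.toIsPolicy hpos,
    ← hπ.integral_condMoment hr, ofReal_integral_eq_lintegral_ofReal
      (hπ.integrable_condMoment hr w)]
  by_cases hw : w = 0
  · refine Eventually.of_forall fun x => ?_
    simp [hw, condMoment]
  · filter_upwards [hπ.toIsPolicy.condMoment_pos hr hw hpos] with x hx using hx.le

/-- Contrasts on an arm with vanishing propensity or infinite cost have infinite value. -/
lemma IsPolicy.invSNRSq_eq_top (hr : IsRegular PX κ ginf) (hπ : IsPolicy PX π) {b : Fin K}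
    (hb : ¬ ((∀ᵐ x ∂PX, 0 < π x b) ∧ Integrable (fun x => totalVar κ ginf x b / π x b) PX))
    {w : Fin K → ℝ} (hwb : w b ≠ 0) : invSNRSq PX κ ginf π w = ∞ := by
  by_cases hpos : ∀ b, w b ≠ 0 → ∀ᵐ x ∂PX, 0 < π x b
  swap
  · rw [invSNRSq, if_neg hpos]
  rw [invSNRSq, if_pos hpos, lintegral_score_sq hr hπ hpos]
  suffices h : ∫⁻ x, ENNReal.ofReal (condMoment PX κ ginf π w x) ∂PX = ∞ by
    rw [h, ENNReal.top_div_of_ne_top ENNReal.ofReal_ne_top]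
  by_contra hfin
  refine hb ⟨hpos b hwb, ?_⟩
  have hw0 : w ≠ 0 := fun h => hwb (by rw [h, Pi.zero_apply])
  have hint : Integrable (condMoment PX κ ginf π w) PX := by
    refine (lintegral_ofReal_ne_top_iff_integrable
      (measurable_condMoment hr.measurable hπ.measurable w).aestronglyMeasurable ?_).1 hfin
    filter_upwards [hπ.condMoment_pos hr hw0 hpos] with x hx using hx.le
  obtain ⟨B, hB0, hB⟩ := hr.exists_residual_le
  -- The only negative part of `condMoment` is bounded by this constant, so an integrable moment
  -- dominates `w b ^ 2` times the cost integrand of `b`.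
  refine Integrable.mono' ((hint.add (integrable_const ((∑ b, |w b| * B) ^ 2))).div_const
    (w b ^ 2)) ((measurable_totalVar κ hr.measurable b).div
      (hπ.measurable b)).aestronglyMeasurable ?_
  filter_upwards [hB, hπ.nonneg, hr.totalVar_pos] with x h1 h2 h3
  have hnn : ∀ a, 0 ≤ totalVar κ ginf x a / π x a := fun a => div_nonneg (h3 a).le (h2 a)
  rw [Real.norm_eq_abs, abs_of_nonneg (hnn b), le_div_iff₀ (by positivity), mul_comm]
  have hres : (∑ b, w b * (ginf x b - condMean κ x b)) ^ 2 ≤ (∑ b, |w b| * B) ^ 2 := by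
    rw [← sq_abs]
    refine pow_le_pow_left₀ (abs_nonneg _) ((Finset.abs_sum_le_sum_abs _ _).trans
      (Finset.sum_le_sum fun a _ => ?_)) 2
    rw [abs_mul]
    exact mul_le_mul_of_nonneg_left (h1 a).2 (abs_nonneg _)
  have hsingle : w b ^ 2 * (totalVar κ ginf x b / π x b) ≤
      ∑ a, w a ^ 2 * (totalVar κ ginf x a / π x a) :=
    Finset.single_le_sum (f := fun a => w a ^ 2 * (totalVar κ ginf x a / π x a))
      (fun a _ => mul_nonneg (sq_nonneg _) (hnn a)) (Finset.mem_univ b)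
  simp only [Pi.add_apply, condMoment]
  linarith [sq_nonneg (∑ b, w b * (condMean κ x b - armMean PX κ b))]

lemma IsPolicy.invSNRSq_eq_top_of_mean_eq_zero (hr : IsRegular PX κ ginf) (hπ : IsPolicy PX π)
    {w : Fin K → ℝ} (hw0 : w ≠ 0) (hw : ∑ b, w b * armMean PX κ b = 0) :
    invSNRSq PX κ ginf π w = ∞ := by
  by_cases hpos : ∀ b, w b ≠ 0 → ∀ᵐ x ∂PX, 0 < π x b
  swap
  · rw [invSNRSq, if_neg hpos]
  rw [invSNRSq, if_pos hpos, lintegral_score_sq hr hπ hpos, hw]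
  simp only [ne_eq, OfNat.ofNat_ne_zero, not_false_eq_true, zero_pow, ENNReal.ofReal_zero]
  -- In `ℝ≥0∞` the quotient 0/0 is 0, so the numerator must be shown nonzero.
  refine ENNReal.div_zero fun h => ?_
  rw [lintegral_eq_zero_iff
    (measurable_condMoment hr.measurable hπ.measurable w).ennreal_ofReal] at h
  obtain ⟨x, hx, hx'⟩ := ((hπ.condMoment_pos hr hw0 hpos).and h).exists
  exact hx.not_ge (ENNReal.ofReal_eq_zero.1 hx')

lemma ne_zero_of_mem_contrastWeights {a : Fin K} {w : Fin K → ℝ} (hw : w ∈ contrastWeights a) :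
    w ≠ 0 := fun h => by
  have := hw.1
  rw [h] at this
  simp at this

/-- A bad suboptimal arm `b` has weight -1 in all contrasts of `contrastWeights b`. If the best arm
is bad, use the second-best arm: an admissible contrast avoiding the best arm has mean zero, hence
infinite value as well. -/
lemma objective_eq_top {astar : Fin K} (hopt : UniqueOptimalArm PX κ astar)
    (hne : ∃ a, a ≠ astar) (hr : IsRegular PX κ ginf) (hπ : IsPolicy PX π)
    (hnot : ¬ IsFinitePolicy PX κ ginf π) : objective PX κ ginf astar π = ∞ := by
  obtain ⟨b, hb⟩ : ∃ b, ¬ ((∀ᵐ x ∂PX, 0 < π x b) ∧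
      Integrable (fun x => totalVar κ ginf x b / π x b) PX) := by
    by_contra! h
    exact hnot ⟨hπ, ae_all_iff.2 fun b => (h b).1, fun b => (h b).2⟩
  suffices h : ∃ a, a ≠ astar ∧ ∀ w ∈ contrastWeights a, 0 ≤ ∑ b, w b * armMean PX κ b →
      invSNRSq PX κ ginf π w = ∞ by
    obtain ⟨a, ha, h⟩ := h
    refine top_le_iff.1 (le_iSup₂_of_le (f := fun a (_ : a ∈ {a : Fin K | a ≠ astar}) =>
      armObjective PX κ ginf a π) a ha ?_)
    exact le_iInf₂ fun w hw => (h w hw.1 hw.2).ge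
  by_cases hbs : b = astar
  · subst hbs
    obtain ⟨a₀, ha₀⟩ := hne
    obtain ⟨a, ha, hmax⟩ := Finset.exists_max_image (Finset.univ.erase b) (armMean PX κ)
      ⟨a₀, Finset.mem_erase.2 ⟨ha₀, Finset.mem_univ a₀⟩⟩
    refine ⟨a, Finset.ne_of_mem_erase ha, fun w hw hmu => ?_⟩
    by_cases hwb : w b = 0
    · refine hπ.invSNRSq_eq_top_of_mean_eq_zero hr (ne_zero_of_mem_contrastWeights hw)
        (le_antisymm ?_ hmu)
      have h : ∑ c ∈ Finset.univ.erase a, w c * armMean PX κ c ≤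
          ∑ c ∈ Finset.univ.erase a, w c * armMean PX κ a := Finset.sum_le_sum fun c hc => by
        by_cases hcb : c = b
        · simp [hcb, hwb]
        · exact mul_le_mul_of_nonneg_left
            (hmax c (Finset.mem_erase.2 ⟨hcb, Finset.mem_univ c⟩))
            (hw.2.1 c (Finset.ne_of_mem_erase hc))
      rw [← Finset.sum_mul, hw.2.2] at h
      rw [← Finset.add_sum_erase _ _ (Finset.mem_univ a), hw.1]
      linarith
    · exact hπ.invSNRSq_eq_top hr hb hwb
  · refine ⟨b, hbs, fun w hw _ => hπ.invSNRSq_eq_top hr hb ?_⟩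
    rw [hw.1]
    norm_num

lemma pair_mem_contrastWeights {s a : Fin K} (ha : a ≠ s) :
    (Pi.single s 1 - Pi.single a 1 : Fin K → ℝ) ∈ contrastWeights a := by
  refine ⟨by simp [ha], fun b hb => ?_, ?_⟩
  · simp only [Pi.sub_apply, Pi.single_eq_of_ne hb, sub_zero, Pi.single_apply]
    split_ifs <;> norm_num
  · have h := Finset.add_sum_erase Finset.univ (Pi.single s 1 - Pi.single a 1 : Fin K → ℝ)
      (Finset.mem_univ a)
    have h2 : ∑ b, (Pi.single s 1 - Pi.single a 1 : Fin K → ℝ) b = 0 := by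
      simp [Finset.sum_sub_distrib]
    rw [h2] at h
    have h3 : (Pi.single s 1 - Pi.single a 1 : Fin K → ℝ) a = -1 := by simp [ha]
    linarith

lemma sum_pair_mul (s a : Fin K) (mu : Fin K → ℝ) :
    ∑ b, (Pi.single s 1 - Pi.single a 1 : Fin K → ℝ) b * mu b = mu s - mu a := by
  simp [sub_mul, Finset.sum_sub_distrib, Pi.single_apply]

lemma IsFinitePolicy.objective_le {astar : Fin K} (hopt : UniqueOptimalArm PX κ astar)
    (hr : IsRegular PX κ ginf) (hπ : IsFinitePolicy PX κ ginf π) {R : ℝ}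
    (hR : ∀ a, a ≠ astar → (armCost PX κ ginf π astar + armCost PX κ ginf π a +
      pairMoment PX κ ginf astar a) / (armMean PX κ astar - armMean PX κ a) ^ 2 ≤ R) :
    objective PX κ ginf astar π ≤ ENNReal.ofReal R := by
  refine iSup₂_le fun a ha => ?_
  have hmu := hopt a ha
  refine (iInf₂_le (Pi.single astar 1 - Pi.single a 1)
    ⟨pair_mem_contrastWeights ha, ?_⟩).trans ?_
  · rw [hπ.invSNRSq_eq hr, sum_pair_mul, quadForm_scoreMoment_pair ha,
      ← ENNReal.ofReal_div_of_pos (by have := sub_pos.2 hmu; positivity)]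
    exact ENNReal.ofReal_le_ofReal (hR a ha)
  · rw [sum_pair_mul]
    linarith

lemma IsFinitePolicy.le_objective {astar : Fin K} (hopt : UniqueOptimalArm PX κ astar)
    (hr : IsRegular PX κ ginf) (hπ : IsFinitePolicy PX κ ginf π) {a : Fin K} (ha : a ≠ astar) :
    ENNReal.ofReal ((armCost PX κ ginf π astar + armCost PX κ ginf π a +
      pairMoment PX κ ginf astar a) / (armMean PX κ astar - armMean PX κ a) ^ 2) ≤
      objective PX κ ginf astar π := by
  have hz := hπ.quadForm_pos hr (ne_zero_of_mem_contrastWeights (pair_mem_contrastWeights ha))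
  obtain ⟨a', ha', h⟩ := exists_contrast_lower_bound (scoreMoment_comm PX κ ginf π)
    (hπ.quadForm_nonneg hr) ha (hopt a ha) hz
  refine le_iSup₂_of_le (f := fun a (_ : a ∈ {a : Fin K | a ≠ astar}) =>
      armObjective PX κ ginf a π) a' ha' (le_iInf₂ fun w hw => ?_)
  by_cases hmu : ∑ b, w b * armMean PX κ b = 0
  · rw [hπ.toIsPolicy.invSNRSq_eq_top_of_mean_eq_zero hr
      (ne_zero_of_mem_contrastWeights hw.1) hmu]
    exact le_top
  · rw [hπ.invSNRSq_eq hr, ← ENNReal.ofReal_div_of_pos (by positivity),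
      ← quadForm_scoreMoment_pair ha]
    refine ENNReal.ofReal_le_ofReal ?_
    rw [le_div_iff₀ (by positivity)]
    exact h w hw.1 hw.2

end Objective

end BAI

namespace BAI

/-! ### Neyman allocations and weak duality. -/

section Optimal

variable {X : Type*} [MeasurableSpace X] {K : ℕ}

/-- The integrated geometric means of the total variances. -/
noncomputable def varOverlap (PX : Measure X) (κ : Kernel (X × Fin K) ℝ)
    (ginf : X → Fin K → ℝ) (b c : Fin K) : ℝ :=
  ∫ x, √(totalVar κ ginf x b) * √(totalVar κ ginf x c) ∂PX

/-- The normalizing factor `∑ √(l b) √(V b)` of the weighted Neyman allocation. -/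
noncomputable def neymanNorm (κ : Kernel (X × Fin K) ℝ) (ginf : X → Fin K → ℝ) (l : Fin K → ℝ)
    (x : X) : ℝ :=
  ∑ c, √(l c) * √(totalVar κ ginf x c)

/-- The Neyman allocation with weights `l`. -/
noncomputable def neyman (κ : Kernel (X × Fin K) ℝ) (ginf : X → Fin K → ℝ) (l : Fin K → ℝ)
    (x : X) (b : Fin K) : ℝ :=
  √(l b) * √(totalVar κ ginf x b) / neymanNorm κ ginf l x

lemma varOverlap_comm (PX : Measure X) (κ : Kernel (X × Fin K) ℝ) (ginf : X → Fin K → ℝ)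
    (b c : Fin K) : varOverlap PX κ ginf b c = varOverlap PX κ ginf c b := by
  simp_rw [varOverlap, mul_comm]

lemma neymanNorm_pos {κ : Kernel (X × Fin K) ℝ} {ginf : X → Fin K → ℝ} {l : Fin K → ℝ}
    (hl : ∀ b, 0 < l b) {x : X} (hV : ∀ a, 0 < totalVar κ ginf x a) (b : Fin K) :
    0 < neymanNorm κ ginf l x :=
  Finset.sum_pos (fun c _ => mul_pos (Real.sqrt_pos.2 (hl c)) (Real.sqrt_pos.2 (hV c)))
    ⟨b, Finset.mem_univ b⟩

lemma totalVar_div_neyman {κ : Kernel (X × Fin K) ℝ} {ginf : X → Fin K → ℝ} {l : Fin K → ℝ}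
    (hl : ∀ b, 0 < l b) {x : X} (hV : ∀ a, 0 < totalVar κ ginf x a) (b : Fin K) :
    totalVar κ ginf x b / neyman κ ginf l x b =
      ∑ c, √(l c) / √(l b) * (√(totalVar κ ginf x b) * √(totalVar κ ginf x c)) := by
  have h1 := Real.sqrt_pos.2 (hl b)
  have h2 := Real.sqrt_pos.2 (hV b)
  have h3 := neymanNorm_pos hl hV b
  have h : totalVar κ ginf x b / neyman κ ginf l x b =
      √(totalVar κ ginf x b) / √(l b) * neymanNorm κ ginf l x := by
    rw [neyman]
    nth_rewrite 1 [← Real.mul_self_sqrt (hV b).le]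
    field_simp
  rw [h, neymanNorm, Finset.mul_sum]
  exact Finset.sum_congr rfl fun c _ => by ring

lemma neyman_inv {κ : Kernel (X × Fin K) ℝ} {ginf : X → Fin K → ℝ} {l : Fin K → ℝ}
    (hl : ∀ b, 0 < l b) {x : X} (hV : ∀ a, 0 < totalVar κ ginf x a) (k b : Fin K) :
    (neyman κ ginf l x b)⁻¹ = ∑ a, √(totalVar κ ginf x a / totalVar κ ginf x b) *
      Real.exp ((Real.log √(l a) - Real.log √(l k)) - (Real.log √(l b) - Real.log √(l k))) := by
  rw [neyman, inv_div, neymanNorm, Finset.sum_div]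
  refine Finset.sum_congr rfl fun a _ => ?_
  rw [sub_sub_sub_cancel_right, Real.exp_sub, Real.exp_log (Real.sqrt_pos.2 (hl a)),
    Real.exp_log (Real.sqrt_pos.2 (hl b)), Real.sqrt_div (hV a).le]
  ring

/-- Completing the square in the weighted allocation problem. -/
lemma sum_sq_sub_div {ι : Type*} [Fintype ι] {l V p : ι → ℝ} (hl : ∀ b, 0 ≤ l b)
    (hV : ∀ b, 0 ≤ V b) (hp : ∀ b, 0 < p b) (hsum : ∑ b, p b = 1) :
    ∑ b, (√(l b) * √(V b) - p b * ∑ c, √(l c) * √(V c)) ^ 2 / p b =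
      ∑ b, l b * (V b / p b) - (∑ c, √(l c) * √(V c)) ^ 2 := by
  set T := ∑ c, √(l c) * √(V c) with hT
  have h : ∀ b, (√(l b) * √(V b) - p b * T) ^ 2 / p b =
      l b * (V b / p b) - 2 * T * (√(l b) * √(V b)) + T ^ 2 * p b := fun b => by
    have := hp b
    nth_rewrite 2 [← Real.mul_self_sqrt (hl b)]
    nth_rewrite 2 [← Real.mul_self_sqrt (hV b)]
    field_simp
    ring
  simp_rw [h, Finset.sum_add_distrib, Finset.sum_sub_distrib, ← Finset.mul_sum, hsum, ← hT]
  ring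

variable {PX : Measure X} [IsProbabilityMeasure PX] {κ : Kernel (X × Fin K) ℝ}
  [IsMarkovKernel κ] {ginf π : X → Fin K → ℝ}

lemma IsRegular.integrable_varOverlap (hr : IsRegular PX κ ginf) (b c : Fin K) :
    Integrable (fun x => √(totalVar κ ginf x b) * √(totalVar κ ginf x c)) PX := by
  obtain ⟨B, hB⟩ := hr.exists_totalVar_le
  have h := measurable_totalVar κ hr.measurable
  refine Integrable.of_bound (C := √B * √B) (Measurable.aestronglyMeasurable (by fun_prop)) ?_
  filter_upwards [hB] with x hx
  rw [Real.norm_eq_abs, abs_of_nonneg (by positivity)]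
  exact mul_le_mul (Real.sqrt_le_sqrt (hx b)) (Real.sqrt_le_sqrt (hx c)) (Real.sqrt_nonneg _)
    (Real.sqrt_nonneg _)

lemma IsRegular.varOverlap_pos (hr : IsRegular PX κ ginf) (b c : Fin K) :
    0 < varOverlap PX κ ginf b c := by
  refine lt_of_le_of_ne (integral_nonneg fun x => by positivity) fun h => ?_
  have h0 := (integral_eq_zero_iff_of_nonneg (fun x => by positivity)
    (hr.integrable_varOverlap b c)).1 h.symm
  obtain ⟨x, hx, hx'⟩ := (hr.totalVar_pos.and h0).exists
  have h1 := Real.sqrt_pos.2 (hx b)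
  have h2 := Real.sqrt_pos.2 (hx c)
  exact (mul_pos h1 h2).ne' hx'

lemma neymanNorm_sq (κ : Kernel (X × Fin K) ℝ) (ginf : X → Fin K → ℝ) (l : Fin K → ℝ) (x : X) :
    neymanNorm κ ginf l x ^ 2 = ∑ b, ∑ c, √(l b) * √(l c) *
      (√(totalVar κ ginf x b) * √(totalVar κ ginf x c)) := by
  rw [sq, neymanNorm, Finset.sum_mul_sum]
  exact Finset.sum_congr rfl fun b _ => Finset.sum_congr rfl fun c _ => by ring

lemma IsRegular.integrable_neymanNorm_sq (hr : IsRegular PX κ ginf) (l : Fin K → ℝ) :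
    Integrable (fun x => neymanNorm κ ginf l x ^ 2) PX := by
  simp_rw [neymanNorm_sq]
  exact integrable_finsetSum _ fun b _ => integrable_finsetSum _ fun c _ =>
    (hr.integrable_varOverlap b c).const_mul _

lemma IsRegular.integral_neymanNorm_sq (hr : IsRegular PX κ ginf) (l : Fin K → ℝ) :
    ∫ x, neymanNorm κ ginf l x ^ 2 ∂PX = allocValue (varOverlap PX κ ginf) l := by
  simp_rw [neymanNorm_sq]
  rw [integral_finsetSum _ fun b _ => integrable_finsetSum _ fun c _ =>
    (hr.integrable_varOverlap b c).const_mul _]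
  refine Finset.sum_congr rfl fun b _ => ?_
  rw [integral_finsetSum _ fun c _ => (hr.integrable_varOverlap b c).const_mul _]
  exact Finset.sum_congr rfl fun c _ => integral_const_mul _ _

lemma isFinitePolicy_neyman (hr : IsRegular PX κ ginf) {l : Fin K → ℝ} (hl : ∀ b, 0 < l b)
    (b₀ : Fin K) : IsFinitePolicy PX κ ginf (neyman κ ginf l) := by
  have hV := measurable_totalVar κ hr.measurable
  refine ⟨⟨fun b => ?_, ?_, ?_⟩, ?_, fun b => ?_⟩
  · unfold neyman neymanNorm
    fun_prop
  · filter_upwards [hr.totalVar_pos] with x hx b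
    exact div_nonneg (by positivity) (neymanNorm_pos hl hx b).le
  · filter_upwards [hr.totalVar_pos] with x hx
    simp_rw [neyman, ← Finset.sum_div]
    exact div_self (neymanNorm_pos hl hx b₀).ne'
  · filter_upwards [hr.totalVar_pos] with x hx b
    exact div_pos (mul_pos (Real.sqrt_pos.2 (hl b)) (Real.sqrt_pos.2 (hx b)))
      (neymanNorm_pos hl hx b)
  · have h : Integrable (fun x => ∑ c, √(l c) / √(l b) *
        (√(totalVar κ ginf x b) * √(totalVar κ ginf x c))) PX :=
      integrable_finsetSum _ fun c _ => (hr.integrable_varOverlap b c).const_mul _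
    refine h.congr ?_
    filter_upwards [hr.totalVar_pos] with x hx using (totalVar_div_neyman hl hx b).symm

/-- The bridge to the dual problem: Neyman costs are the gradient of the allocation value. -/
lemma armCost_neyman (hr : IsRegular PX κ ginf) {l : Fin K → ℝ} (hl : ∀ b, 0 < l b)
    (b : Fin K) : armCost PX κ ginf (neyman κ ginf l) b =
      allocCost (varOverlap PX κ ginf) l b := by
  rw [armCost, integral_congr_ae (g := fun x => ∑ c, √(l c) / √(l b) *
        (√(totalVar κ ginf x b) * √(totalVar κ ginf x c))),
    integral_finsetSum _ fun c _ => (hr.integrable_varOverlap b c).const_mul _]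
  · exact Finset.sum_congr rfl fun c _ => integral_const_mul _ _
  · filter_upwards [hr.totalVar_pos] with x hx using totalVar_div_neyman hl hx b

/-- The Neyman allocation is the unique minimizer of the weighted sum of costs. -/
lemma IsFinitePolicy.allocValue_le (hr : IsRegular PX κ ginf) (hπ : IsFinitePolicy PX κ ginf π)
    {l : Fin K → ℝ} (hl : ∀ b, 0 < l b) :
    allocValue (varOverlap PX κ ginf) l ≤ ∑ b, l b * armCost PX κ ginf π b ∧
      (∑ b, l b * armCost PX κ ginf π b ≤ allocValue (varOverlap PX κ ginf) l →
        ∀ᵐ x ∂PX, ∀ b, π x b = neyman κ ginf l x b) := by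
  -- The pointwise Cauchy-Schwarz gap, a sum of squares over propensities; its integral is the
  -- excess cost, so zero excess forces every square to vanish almost everywhere.
  set D : X → ℝ := fun x => ∑ b, l b * (totalVar κ ginf x b / π x b) -
    neymanNorm κ ginf l x ^ 2 with hD
  have hsumint : Integrable (fun x => ∑ b, l b * (totalVar κ ginf x b / π x b)) PX :=
    integrable_finsetSum _ fun b _ => (hπ.integrable b).const_mul _
  have hDint : Integrable D PX := hsumint.sub (hr.integrable_neymanNorm_sq l)
  have hval : ∫ x, D x ∂PX =
      ∑ b, l b * armCost PX κ ginf π b - allocValue (varOverlap PX κ ginf) l := by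
    rw [hD, integral_sub hsumint (hr.integrable_neymanNorm_sq l), hr.integral_neymanNorm_sq,
      integral_finsetSum _ fun b _ => (hπ.integrable b).const_mul _]
    congr 1
    exact Finset.sum_congr rfl fun b _ => integral_const_mul _ _
  have hsq : ∀ᵐ x ∂PX, D x = ∑ b, (√(l b) * √(totalVar κ ginf x b) -
      π x b * neymanNorm κ ginf l x) ^ 2 / π x b := by
    filter_upwards [hπ.pos, hπ.sum_eq_one, hr.totalVar_pos] with x h1 h2 h3
    exact (sum_sq_sub_div (fun b => (hl b).le) (fun b => (h3 b).le) h1 h2).symm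
  have hnn : 0 ≤ᵐ[PX] D := by
    filter_upwards [hsq, hπ.pos] with x h1 h2
    rw [h1]
    exact Finset.sum_nonneg fun b _ => div_nonneg (sq_nonneg _) (h2 b).le
  have h0 := integral_nonneg_of_ae hnn
  rw [hval] at h0
  refine ⟨by linarith, fun hle => ?_⟩
  have hzero : D =ᵐ[PX] 0 :=
    (integral_eq_zero_iff_of_nonneg_ae hnn hDint).1 (by rw [hval]; linarith)
  filter_upwards [hzero, hsq, hπ.pos, hr.totalVar_pos] with x h1 h2 h3 h4 b
  rw [h1, Pi.zero_apply] at h2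
  have h5 := (Finset.sum_eq_zero_iff_of_nonneg fun b _ =>
    div_nonneg (sq_nonneg _) (h3 b).le).1 h2.symm b (Finset.mem_univ b)
  have h6 : √(l b) * √(totalVar κ ginf x b) - π x b * neymanNorm κ ginf l x = 0 := by
    rcases div_eq_zero_iff.1 h5 with h | h
    · exact pow_eq_zero_iff two_ne_zero |>.1 h
    · exact absurd h (h3 b).ne'
  rw [neyman, eq_div_iff (neymanNorm_pos hl h4 b).ne']
  linarith

/-- Weak duality: a policy with objective at most the dual value is the Neyman allocation, and
no policy does better. -/
lemma le_objective_and_eq_neyman {astar : Fin K} (hopt : UniqueOptimalArm PX κ astar)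
    (hne : ∃ a, a ≠ astar) (hr : IsRegular PX κ ginf) {l : Fin K → ℝ} (hl : ∀ b, 0 < l b)
    (hmem : l ∈ multipliers astar fun a => (armMean PX κ astar - armMean PX κ a) ^ 2)
    {R : ℝ} (hR : R = dualValue (varOverlap PX κ ginf) (pairMoment PX κ ginf astar) astar l)
    (hπ : IsPolicy PX π) :
    ENNReal.ofReal R ≤ objective PX κ ginf astar π ∧
      (objective PX κ ginf astar π ≤ ENNReal.ofReal R →
        ∀ᵐ x ∂PX, ∀ b, π x b = neyman κ ginf l x b) := by
  by_cases hfin : IsFinitePolicy PX κ ginf π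
  swap
  · rw [objective_eq_top hopt hne hr hπ hfin]
    exact ⟨le_top, fun h => absurd (top_le_iff.1 h) ENNReal.ofReal_ne_top⟩
  set f : Fin K → ℝ := fun a => (armCost PX κ ginf π astar + armCost PX κ ginf π a +
      pairMoment PX κ ginf astar a) with hf
  set d : Fin K → ℝ := fun a => (armMean PX κ astar - armMean PX κ a) ^ 2 with hd
  have hdpos : ∀ a, a ≠ astar → 0 < d a := fun a ha => by
    have := sub_pos.2 (hopt a ha)
    simp only [hd]
    positivity
  -- The Lagrangian is an average of the pairwise values, with weights `d a * l a` of total mass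
  -- one.
  have hlag : ∑ b, l b * armCost PX κ ginf π b +
      ∑ a ∈ Finset.univ.erase astar, l a * pairMoment PX κ ginf astar a =
      ∑ a ∈ Finset.univ.erase astar, d a * l a * (f a / d a) := by
    rw [multipliers_sum hmem, ← Finset.sum_add_distrib]
    refine Finset.sum_congr rfl fun a ha => ?_
    have := hdpos a (Finset.ne_of_mem_erase ha)
    field_simp
    simp only [hf]
  obtain ⟨hle, heq⟩ := hfin.allocValue_le hr hl
  rw [dualValue] at hR
  have hweight : ∀ r : ℝ, ∑ a ∈ Finset.univ.erase astar, d a * l a * r = r := fun r => by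
    rw [← Finset.sum_mul, hmem.2.2, one_mul]
  have hwpos : ∀ a ∈ Finset.univ.erase astar, 0 < d a * l a := fun a ha =>
    mul_pos (hdpos a (Finset.ne_of_mem_erase ha)) (hl a)
  constructor
  · obtain ⟨a, ha, hfa⟩ : ∃ a ∈ Finset.univ.erase astar, R ≤ f a / d a := by
      by_contra! h
      obtain ⟨a₀, ha₀⟩ := hne
      have hlt := Finset.sum_lt_sum_of_nonempty
        ⟨a₀, Finset.mem_erase.2 ⟨ha₀, Finset.mem_univ a₀⟩⟩
        fun a ha => mul_lt_mul_of_pos_left (h a ha) (hwpos a ha)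
      rw [hweight, ← hlag] at hlt
      linarith
    exact (ENNReal.ofReal_le_ofReal hfa).trans
      (hfin.le_objective hopt hr (Finset.ne_of_mem_erase ha))
  · intro hobj
    refine heq ?_
    have hfR : ∀ a ∈ Finset.univ.erase astar, f a / d a ≤ R := fun a ha => by
      have has := Finset.ne_of_mem_erase ha
      have hfpos : 0 < f a / d a := by
        have := hfin.quadForm_pos hr (ne_zero_of_mem_contrastWeights (pair_mem_contrastWeights has))
        rw [quadForm_scoreMoment_pair has] at this
        exact div_pos this (hdpos a has)
      have := (hfin.le_objective hopt hr has).trans hobj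
      -- `ENNReal.ofReal` truncates at 0; positivity of the pairwise value rules out the degenerate
      -- case.
      rcases ENNReal.ofReal_le_ofReal_iff'.1 this with h | h
      · exact h
      · exact absurd h hfpos.not_ge
    have hsum := Finset.sum_le_sum fun a ha =>
      mul_le_mul_of_nonneg_left (hfR a ha) (hwpos a ha).le
    rw [hweight, ← hlag] at hsum
    linarith

end Optimal

end BAI

/-! ### The main theorem. -/

theorem mainTheorem7 {X Ω : Type*} [MeasurableSpace X] [MeasurableSpace Ω] {K : ℕ} (hK : 0 < K)
    (PX : Measure X) [IsProbabilityMeasure PX]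
    (κ : Kernel (X × Fin K) ℝ) [IsMarkovKernel κ]
    (P : Measure Ω) [IsProbabilityMeasure P]
    (gseq : ℕ → Ω → X → Fin K → ℝ) (ginf : X → Fin K → ℝ)
    (piinf : X → Fin K → ℝ) (astar : Fin K)
    (hopt : BAI.UniqueOptimalArm PX κ astar)
    (hvar : BAI.NondegenerateVariances PX κ)
    (hbdd : BAI.BoundedOutcomes PX κ)
    (hA2 : BAI.RegressionConverges P PX gseq ginf)
    (hpiinf : BAI.IsPolicy PX piinf)
    (hA3 : IsUnit (BAI.scoreCov PX κ ginf piinf)) :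
    ∃ pistar : X → Fin K → ℝ,
      BAI.IsOptimalPolicy PX κ ginf astar pistar ∧
      (∀ π, BAI.IsOptimalPolicy PX κ ginf astar π → ∀ᵐ x ∂PX, ∀ b, π x b = pistar x b) ∧
      ∃ θ : Fin K → ℝ, θ ⟨K - 1, Nat.sub_lt hK one_pos⟩ = 0 ∧
        ∀ᵐ x ∂PX, ∀ b, (pistar x b)⁻¹ =
          ∑ a, Real.sqrt (BAI.totalVar κ ginf x a / BAI.totalVar κ ginf x b) *
            Real.exp (θ a - θ b) := by
  have hr : BAI.IsRegular PX κ ginf := BAI.isRegular hvar hbdd hA2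
  by_cases hne : ∃ a, a ≠ astar
  · obtain ⟨l, hmem, hl, hle⟩ := BAI.exists_multipliers (fun b c => hr.varOverlap_pos b c)
      (BAI.varOverlap_comm PX κ ginf) (BAI.pairMoment PX κ ginf astar)
      (s := astar) (e := fun a => (BAI.armMean PX κ astar - BAI.armMean PX κ a) ^ 2)
      (fun a ha => by have := sub_pos.2 (hopt a ha); positivity) hne
    have hfin := BAI.isFinitePolicy_neyman hr hl astar
    have hupper := hfin.objective_le hopt hr fun a ha => by
      rw [BAI.armCost_neyman hr hl, BAI.armCost_neyman hr hl]
      exact hle a ha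
    refine ⟨BAI.neyman κ ginf l, ⟨hfin.toIsPolicy, fun π hπ => hupper.trans
      (BAI.le_objective_and_eq_neyman hopt hne hr hl hmem rfl hπ).1⟩, fun π hπ =>
      (BAI.le_objective_and_eq_neyman hopt hne hr hl hmem rfl hπ.1).2
        ((hπ.2 _ hfin.toIsPolicy).trans hupper),
      fun a => Real.log √(l a) - Real.log √(l ⟨K - 1, Nat.sub_lt hK one_pos⟩), sub_self _, ?_⟩
    filter_upwards [hr.totalVar_pos] with x hx b using BAI.neyman_inv hl hx _ b
  -- With a single arm the objective is an empty supremum, and the sum condition leaves only the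
  -- constant policy 1.
  · push Not at hne
    have hsum : ∀ (f : Fin K → ℝ), ∑ a, f a = f astar := fun f =>
      Fintype.sum_eq_single astar fun b hb => absurd (hne b) hb
    refine ⟨fun _ _ => 1, ⟨⟨fun _ => measurable_const, by simp,
      Eventually.of_forall fun x => hsum _⟩, fun π _ => ?_⟩, fun π hπ => ?_, fun _ => 0, rfl, ?_⟩
    · simp [BAI.objective, hne]
    · filter_upwards [hπ.1.sum_eq_one] with x hx b
      rw [hne b, ← hx, hsum]
    · filter_upwards [hr.totalVar_pos] with x hx b
      rw [hsum, hne b, div_self (hx astar).ne']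
      simp
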